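/- **Besicovitch–Derrick–Almgren $\square$-inequality.** Let $P$ be an $n$-cubical metric space, i.e. a metric space with $n$ pairs of disjoint closed subsets $Q_i,-Q_i\subset P$ ($i=1,\dots,n$), the *faces*, and put $\partial P=\bigcup_i(Q_i\cup -Q_i)$. Let $\square=[0,1]^n$ with its faces $\{y_i=1\}$ and $\{y_i=0\}$, let $F$ be an abelian group, and let $H^*(\cdot,\cdot;F)$ denote Čech cohomology of pairs. Let $\pi:P\to\square$ be a continuous map with $\pi(Q_i)\subset\{y_i=1\}$, $\pi(-Q_i)\subset\{y_i=0\}$ for all $i$. If the induced homomorphism $\pi^*:H^n(\square,\partial\square;F)\to H^n(P,\partial P;F)$ is nonzero, then $$vol^{[n]}(P)\ \ge\ \prod_{i=1}^n dist_P(Q_i,-Q_i),\qquad dist_P(A,B)=\inf_{a\in A,\,b\in B}dist(a,b),$$ where $vol^{[n]}$ is the $F$-homological Hilbertian volume, with values in $[0,\infty]$, defined as follows. * *Hilbert constant.* An axial projector of a normed space $Y$ is a pair $(a,p)$ of a linear isometric embedding $a:\mathbb R\to Y$ and a linear map $p:Y\to\mathbb R$ with $p\circ a=\mathrm{id}$ and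 $\|p\|=1$. An axial partition of unity is a Borel measure $\mu$ on the space $\mathcal P$ of axial projectors with $\int_{\mathcal P} a(p(y))\,d\mu=y$ for all $y\in Y$. For a map $f:X\to Y$ from a metric space let $\|\min.\widetilde{dil}^*f\|_{L_2}$ be the infimum of $\big(\int_{\mathcal P} Lip(g_p)^2\,d\mu\big)^{1/2}$ over all axial partitions of unity $\mu$ and all families of functions $g_p:X\to\mathbb R$, $(a,p)\in\mathcal P$, with $p\mapsto g_p(x)$ in $L_2(\mu)$ and $\int_{\mathcal P} a(g_p(x))\,d\mu=f(x)$ for every $x\in X$. Put $\widetilde{Hilb}(f)=\|\min.\widetilde{dil}^*f\|_{L_2}/\|\min.\widetilde{dil}^*\mathrm{id}_Y\|_{L_2}$ (read as $0$ when $Y=0$, where both terms vanish). * *Hilbert Jacobian.* For $f:X\to\mathbb R^n$ and $x\in X$ let $\widetilde{Hil}Jac^{[n]}f(x)=\inf_{U,\varphi}\widetilde{Hilb}(\varphi\circ f|_U)^n$, over the neighbourhoods $U$ of $x$ and the smooth diffeomorphisms $\varphi$ of the Euclidean space $\mathbb R^n$ with $|\det D\varphi|\ge1$ everywhere. * *Stable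 points.* A point $y\in\mathbb R^n$ is stable for a continuous $f:X\to\mathbb R^n$ if for all sufficiently small neighbourhoods $V$ of $y$ the homomorphism $H^n(V,\partial V;F)\to H^n(f^{-1}(V),f^{-1}(\partial V);F)$ is nonzero (with $V\cup\partial V$ in place of $V$ when $V$ is not closed). * *Volume.* $glb\,vol^{[n]}(X)$ is the supremum of the Lebesgue measures of the sets of stable points of $f$, over all Lipschitz maps $f:X\to\mathbb R^n$ with $\widetilde{Hil}Jac^{[n]}f(x)\le1$ for all $x\in X$. Finally $$vol^{[n]}(P)=\sup_{m,\,(U_i)}\frac1m\sum_i glb\,vol^{[n]}(U_i)$$ over all integers $m\ge1$ and all countable systems $(U_i)$ of open subsets of $P$ such that every point lies in at most $m$ of the $U_i$. -/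

import Mathlib

open MeasureTheory Set
open scoped ENNReal NNReal Topology Manifold ContDiff

noncomputable section

/-! ### Čech cohomology of pairs -/

/-- An open cover of `X` indexed by the points of `X`, the point `x` lying in the member `U x`.
Every open cover (of a space, or of a pair) is refined by one of this form, so the direct limit
over all open covers may be computed along these; refinements are then given by the identity
on indices. -/
structure PointCover (X : Type*) [TopologicalSpace X] where
  toFun : X → Set X
  isOpen : ∀ x, IsOpen (toFun x)
  mem : ∀ x, x ∈ toFun x

/-- The common refinement of two covers. -/
def PointCover.inf {X : Type*} [TopologicalSpace X] (U V : PointCover X) : PointCover X where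
  toFun x := U.toFun x ∩ V.toFun x
  isOpen x := (U.isOpen x).inter (V.isOpen x)
  mem x := ⟨U.mem x, V.mem x⟩

/-- The trivial cover. -/
def PointCover.top (X : Type*) [TopologicalSpace X] : PointCover X where
  toFun _ := univ
  isOpen _ := isOpen_univ
  mem x := mem_univ x

/-- The pulled back cover. -/
def PointCover.pullback {X Y : Type*} [TopologicalSpace X] [TopologicalSpace Y]
    (f : C(X, Y)) (U : PointCover Y) : PointCover X where
  toFun x := f ⁻¹' U.toFun (f x)
  isOpen x := (U.isOpen (f x)).preimage f.continuous
  mem x := U.mem (f x)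

/-- The ordered `n`-simplices of the nerve of the cover that `U` induces on the subspace `A`:
`(n+1)`-tuples of indices in `A` whose members have a common point in `A`.  For `A = univ` this
is the nerve of `U`. -/
def PointCover.nerve {X : Type*} [TopologicalSpace X] (U : PointCover X) (A : Set X) (n : ℕ) :
    Set (Fin (n + 1) → X) :=
  {x | (∀ i, x i ∈ A) ∧ ∃ z ∈ A, ∀ i, z ∈ U.toFun (x i)}

/-- `n`-cochains, as functions on all `(n+1)`-tuples of indices; only the values on the nerve
of a sufficiently fine cover matter below. -/
abbrev CechCochain (X F : Type*) (n : ℕ) := (Fin (n + 1) → X) → F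

/-- The simplicial coboundary. -/
def cechDelta {X F : Type*} [AddCommGroup F] {n : ℕ} (φ : CechCochain X F n) :
    CechCochain X F (n + 1) :=
  fun x => ∑ i : Fin (n + 2), (-1 : ℤ) ^ (i : ℕ) • φ (fun j => x (i.succAbove j))

theorem cechDelta_add {X F : Type*} [AddCommGroup F] {n : ℕ} (φ ψ : CechCochain X F n) :
    cechDelta (φ + ψ) = cechDelta φ + cechDelta ψ := by
  funext x; simp [cechDelta, Finset.sum_add_distrib]

theorem cechDelta_neg {X F : Type*} [AddCommGroup F] {n : ℕ} (φ : CechCochain X F n) :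
    cechDelta (-φ) = -cechDelta φ := by
  funext x; simp [cechDelta]

theorem cechDelta_zero {X F : Type*} [AddCommGroup F] {n : ℕ} :
    cechDelta (0 : CechCochain X F n) = 0 := by
  funext x; simp [cechDelta]

/-- Relative Čech cocycles of `(X, A)`: on the nerve of some open cover, `φ` is a simplicial
cocycle which vanishes on the subcomplex given by `A`. -/
def cechCocycles (X : Type*) [TopologicalSpace X] (A : Set X) (F : Type*) [AddCommGroup F]
    (n : ℕ) : AddSubgroup (CechCochain X F n) where
  carrier := {φ | ∃ U : PointCover X, (∀ x ∈ U.nerve A n, φ x = 0) ∧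
    ∀ x ∈ U.nerve univ (n + 1), cechDelta φ x = 0}
  zero_mem' := ⟨PointCover.top X, fun _ _ => rfl, fun _ _ => by rw [cechDelta_zero]; rfl⟩
  neg_mem' := by
    rintro φ ⟨U, h1, h2⟩
    refine ⟨U, fun x hx => ?_, fun x hx => ?_⟩
    · simp [h1 x hx]
    · rw [cechDelta_neg]; simp [h2 x hx]
  add_mem' := by
    rintro φ ψ ⟨U, h1, h2⟩ ⟨V, k1, k2⟩
    refine ⟨U.inf V, fun x hx => ?_, fun x hx => ?_⟩
    · obtain ⟨ha, z, hz, h⟩ := hx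
      simp [h1 x ⟨ha, z, hz, fun i => (h i).1⟩, k1 x ⟨ha, z, hz, fun i => (h i).2⟩]
    · obtain ⟨ha, z, hz, h⟩ := hx
      rw [cechDelta_add]
      simp [h2 x ⟨ha, z, hz, fun i => (h i).1⟩, k2 x ⟨ha, z, hz, fun i => (h i).2⟩]

/-- Relative Čech coboundaries of `(X, A)`: cochains which, on the nerve of some open cover,
are `0` (degree `0`) or the simplicial coboundary of a cochain vanishing on the subcomplex
given by `A` (positive degree). -/
def IsCechCoboundary {X : Type*} [TopologicalSpace X] (A : Set X) {F : Type*} [AddCommGroup F] :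
    (n : ℕ) → CechCochain X F n → Prop
  | 0, φ => ∃ U : PointCover X, ∀ x ∈ U.nerve univ 0, φ x = 0
  | n + 1, φ => ∃ U : PointCover X, ∃ ψ : CechCochain X F n, (∀ x ∈ U.nerve A n, ψ x = 0) ∧
      ∀ x ∈ U.nerve univ (n + 1), φ x = cechDelta ψ x

def cechCoboundaries (X : Type*) [TopologicalSpace X] (A : Set X) (F : Type*) [AddCommGroup F]
    (n : ℕ) : AddSubgroup (CechCochain X F n) where
  carrier := {φ | IsCechCoboundary A n φ}
  zero_mem' := by
    cases n with
    | zero => exact ⟨PointCover.top X, fun _ _ => rfl⟩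
    | succ n => exact ⟨PointCover.top X, 0, fun _ _ => rfl, fun _ _ => by rw [cechDelta_zero]⟩
  neg_mem' := by
    intro φ hφ
    cases n with
    | zero =>
      obtain ⟨U, h⟩ := hφ
      exact ⟨U, fun x hx => by simp [h x hx]⟩
    | succ n =>
      obtain ⟨U, ψ, h1, h2⟩ := hφ
      exact ⟨U, -ψ, fun x hx => by simp [h1 x hx],
        fun x hx => by rw [cechDelta_neg]; simp [h2 x hx]⟩
  add_mem' := by
    intro φ φ' hφ hφ'
    cases n with
    | zero =>
      obtain ⟨U, h⟩ := hφ
      obtain ⟨V, k⟩ := hφ'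
      refine ⟨U.inf V, fun x hx => ?_⟩
      obtain ⟨ha, z, hz, hx⟩ := hx
      simp [h x ⟨ha, z, hz, fun i => (hx i).1⟩, k x ⟨ha, z, hz, fun i => (hx i).2⟩]
    | succ n =>
      obtain ⟨U, ψ, h1, h2⟩ := hφ
      obtain ⟨V, ψ', k1, k2⟩ := hφ'
      refine ⟨U.inf V, ψ + ψ', fun x hx => ?_, fun x hx => ?_⟩
      · obtain ⟨ha, z, hz, h⟩ := hx
        simp [h1 x ⟨ha, z, hz, fun i => (h i).1⟩, k1 x ⟨ha, z, hz, fun i => (h i).2⟩]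
      · obtain ⟨ha, z, hz, h⟩ := hx
        rw [cechDelta_add]
        simp [h2 x ⟨ha, z, hz, fun i => (h i).1⟩, k2 x ⟨ha, z, hz, fun i => (h i).2⟩]

/-- The Čech cohomology group `Hⁿ(X, A; F)`, the direct limit over the open covers of the
simplicial cohomology of the pairs of nerves, as cocycles modulo coboundaries. -/
abbrev CechH (X : Type*) [TopologicalSpace X] (A : Set X) (F : Type*) [AddCommGroup F] (n : ℕ) :=
  cechCocycles X A F n ⧸ (cechCoboundaries X A F n).addSubgroupOf (cechCocycles X A F n)

/-- Pull-back of cochains. -/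
def cechPull {X Y : Type*} (F : Type*) [AddCommGroup F] (n : ℕ) (f : X → Y) :
    CechCochain Y F n →+ CechCochain X F n where
  toFun φ := fun x => φ (fun i => f (x i))
  map_zero' := rfl
  map_add' _ _ := rfl

theorem PointCover.nerve_pullback {X Y : Type*} [TopologicalSpace X] [TopologicalSpace Y]
    {A : Set X} {B : Set Y} (f : C(X, Y)) (hf : MapsTo f A B) (U : PointCover Y) {n : ℕ}
    {x : Fin (n + 1) → X} (hx : x ∈ (U.pullback f).nerve A n) :
    (fun i => f (x i)) ∈ U.nerve B n := by
  obtain ⟨ha, z, hz, h⟩ := hx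
  exact ⟨fun i => hf (ha i), f z, hf hz, fun i => h i⟩

theorem cechPull_cocycles {X Y : Type*} [TopologicalSpace X] [TopologicalSpace Y]
    {A : Set X} {B : Set Y} (F : Type*) [AddCommGroup F] (n : ℕ) (f : C(X, Y))
    (hf : MapsTo f A B) :
    cechCocycles Y B F n ≤ (cechCocycles X A F n).comap (cechPull F n f) := by
  rintro φ ⟨U, h1, h2⟩
  exact ⟨U.pullback f, fun x hx => h1 _ (U.nerve_pullback f hf hx),
    fun x hx => h2 _ (U.nerve_pullback f (mapsTo_univ _ _) hx)⟩

theorem cechPull_coboundaries {X Y : Type*} [TopologicalSpace X] [TopologicalSpace Y]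
    {A : Set X} {B : Set Y} (F : Type*) [AddCommGroup F] (n : ℕ) (f : C(X, Y))
    (hf : MapsTo f A B) :
    cechCoboundaries Y B F n ≤ (cechCoboundaries X A F n).comap (cechPull F n f) := by
  intro φ hφ
  cases n with
  | zero =>
    obtain ⟨U, h⟩ := hφ
    exact ⟨U.pullback f, fun x hx => h _ (U.nerve_pullback f (mapsTo_univ _ _) hx)⟩
  | succ n =>
    obtain ⟨U, ψ, h1, h2⟩ := hφ
    exact ⟨U.pullback f, cechPull F n f ψ, fun x hx => h1 _ (U.nerve_pullback f hf hx),
      fun x hx => h2 _ (U.nerve_pullback f (mapsTo_univ _ _) hx)⟩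

/-- The homomorphism `Hⁿ(Y, B; F) → Hⁿ(X, A; F)` induced by a map of pairs. -/
def cechMap {X Y : Type*} [TopologicalSpace X] [TopologicalSpace Y]
    {A : Set X} {B : Set Y} (F : Type*) [AddCommGroup F] (n : ℕ) (f : C(X, Y))
    (hf : MapsTo f A B) : CechH Y B F n →+ CechH X A F n :=
  QuotientAddGroup.map _ _
    (((cechPull F n f).comp (cechCocycles Y B F n).subtype).codRestrict (cechCocycles X A F n)
      (fun φ => cechPull_cocycles F n f hf φ.2))
    (fun _ hφ => cechPull_coboundaries F n f hf hφ)

/-! ### Axial projectors, partitions of unity and dilations -/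

/-- An axial projector in a normed space `Y`: a linear isometric embedding `a : ℝ → Y` with a
linear projector of norm one onto its image; `proj` is this projector, read in `ℝ` through `a`. -/
structure AxialProjector (Y : Type*) [NormedAddCommGroup Y] [NormedSpace ℝ Y] where
  axis : ℝ →ₗᵢ[ℝ] Y
  proj : Y →L[ℝ] ℝ
  proj_axis : ∀ t, proj (axis t) = t
  norm_proj : ‖proj‖ = 1

instance (Y : Type*) [NormedAddCommGroup Y] [NormedSpace ℝ Y] :
    TopologicalSpace (AxialProjector Y) :=
  TopologicalSpace.induced (fun q => (q.axis 1, q.proj)) inferInstance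

instance (Y : Type*) [NormedAddCommGroup Y] [NormedSpace ℝ Y] :
    MeasurableSpace (AxialProjector Y) := borel _

instance (Y : Type*) [NormedAddCommGroup Y] [NormedSpace ℝ Y] :
    BorelSpace (AxialProjector Y) := ⟨rfl⟩

/-- An axial partition of unity: a Borel measure with `∫ p dμ(p) = id`. -/
def IsAxialPartition {Y : Type*} [NormedAddCommGroup Y] [NormedSpace ℝ Y]
    (μ : Measure (AxialProjector Y)) : Prop :=
  ∀ y : Y, Integrable (fun q : AxialProjector Y => q.axis (q.proj y)) μ ∧
    ∫ q, q.axis (q.proj y) ∂μ = y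

/-- A family `g` of real functions on `X`, indexed by the axial projectors, which is a map
`X → L₂(μ)` with `∫ a_p (g_p x) dμ(p) = f x` for all `x`. -/
def IsLift {X Y : Type*} [NormedAddCommGroup Y] [NormedSpace ℝ Y]
    (μ : Measure (AxialProjector Y)) (f : X → Y) (g : AxialProjector Y → X → ℝ) : Prop :=
  ∀ x, MemLp (fun q => g q x) 2 μ ∧ Integrable (fun q => q.axis (g q x)) μ ∧
    ∫ q, q.axis (g q x) ∂μ = f x

/-- The `L̃₂`-dilation of `f` for `μ`, the infimum of `(∫ Lip(g_p)² dμ(p))^(1/2)` over the lifts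
`g` of `f`.  The integral is taken over measurable bounds `K p` of `Lip(g_p)`, which makes no
difference when `p ↦ Lip(g_p)` is itself measurable. -/
def tildeDil {X Y : Type*} [PseudoEMetricSpace X] [NormedAddCommGroup Y] [NormedSpace ℝ Y]
    (μ : Measure (AxialProjector Y)) (f : X → Y) : ℝ≥0∞ :=
  ⨅ (g : AxialProjector Y → X → ℝ) (_ : IsLift μ f g)
    (K : AxialProjector Y → ℝ≥0) (_ : Measurable K) (_ : ∀ q, LipschitzWith (K q) (g q)),
    (∫⁻ q, (K q : ℝ≥0∞) ^ 2 ∂μ) ^ (1 / 2 : ℝ)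

/-- The minimal `L̃₂`-dilation, over all axial partitions of unity. -/
def minTildeDil {X Y : Type*} [PseudoEMetricSpace X] [NormedAddCommGroup Y] [NormedSpace ℝ Y]
    (f : X → Y) : ℝ≥0∞ :=
  ⨅ (μ : Measure (AxialProjector Y)) (_ : IsAxialPartition μ), tildeDil μ f

/-- The Hilbert constant of `f`. -/
def tildeHilb {X Y : Type*} [PseudoEMetricSpace X] [NormedAddCommGroup Y] [NormedSpace ℝ Y]
    (f : X → Y) : ℝ≥0∞ :=
  minTildeDil f / minTildeDil (id : Y → Y)

/-! ### Hilbert Jacobian, stable image and Hilbertian volume -/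

/-- Euclidean `n`-space. -/
abbrev EucSpace (n : ℕ) := EuclideanSpace ℝ (Fin n)

/-- The global Hilbert Jacobian of the restriction of `f : X → ℝⁿ` to `U`: the infimum of
`tildeHilb (φ ∘ f|_U) ^ n` over the diffeomorphisms `φ` of `ℝⁿ` with Jacobian at least `1`. -/
def hilJacGlb {n : ℕ} {X : Type*} [PseudoEMetricSpace X] (f : X → EucSpace n) (U : Set X) :
    ℝ≥0∞ :=
  ⨅ (φ : EucSpace n ≃ₘ^∞⟮𝓘(ℝ, EucSpace n), 𝓘(ℝ, EucSpace n)⟯ EucSpace n)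
    (_ : ∀ v, 1 ≤ |(fderiv ℝ φ v).det|), tildeHilb (fun u : U => φ (f u)) ^ n

/-- The Hilbert Jacobian of `f : X → ℝⁿ` at `x`. -/
def hilJac {n : ℕ} {X : Type*} [PseudoEMetricSpace X] (f : X → EucSpace n) (x : X) : ℝ≥0∞ :=
  ⨅ (U : Set X) (_ : U ∈ 𝓝 x), hilJacGlb f U

/-- `f` restricted to the preimage of `V`. -/
def restrictTo {X Y : Type*} [TopologicalSpace X] [TopologicalSpace Y] (f : C(X, Y))
    (V : Set Y) : C(f ⁻¹' V, V) :=
  ⟨V.restrictPreimage f, f.continuous.restrictPreimage⟩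

/-- `y` is cohomologically stable for `f` if, for all sufficiently small neighbourhoods `V` of
`y`, the homomorphism `Hⁿ(V, ∂V; F) → Hⁿ(f⁻¹ V, f⁻¹ ∂V; F)` does not vanish.  The frontier of `V`
is only contained in `V` when `V` is closed; otherwise `V` is replaced by `V ∪ ∂V`. -/
def IsStablePoint {X Y : Type*} [TopologicalSpace X] [TopologicalSpace Y]
    (F : Type*) [AddCommGroup F] (n : ℕ) (f : C(X, Y)) (y : Y) : Prop :=
  ∃ W ∈ 𝓝 y, ∀ V ∈ 𝓝 y, V ⊆ W →
    cechMap (A := {x : f ⁻¹' closure V | f x ∈ frontier V})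
      (B := {z : closure V | (z : Y) ∈ frontier V})
      F n (restrictTo f (closure V)) (fun _ hx => hx) ≠ 0

/-- The stable part of the image of `f`. -/
def stableImage {X Y : Type*} [TopologicalSpace X] [TopologicalSpace Y]
    (F : Type*) [AddCommGroup F] (n : ℕ) (f : C(X, Y)) : Set Y :=
  {y | IsStablePoint F n f y}

/-- The global `n`-volume of `X` over `ℝⁿ`: the supremum of the Lebesgue measures of the stable
images of the Lipschitz maps `X → ℝⁿ` with Hilbert Jacobian at most one everywhere. -/
def glbVol (F : Type*) [AddCommGroup F] (n : ℕ) (X : Type*) [PseudoEMetricSpace X] : ℝ≥0∞ :=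
  ⨆ (f : C(X, EucSpace n)) (_ : ∃ K : ℝ≥0, LipschitzWith K f) (_ : ∀ x, hilJac f x ≤ 1),
    volume (stableImage F n f)

/-- The homological Hilbertian `n`-volume: the supremum of `m⁻¹ ∑ᵢ glbVol (Uᵢ)` over the countable
systems of open subsets of multiplicity at most `m` (finite systems are completed by empty sets). -/
def hilVol (F : Type*) [AddCommGroup F] (n : ℕ) (X : Type*) [PseudoEMetricSpace X] : ℝ≥0∞ :=
  ⨆ (U : ℕ → Set X) (_ : ∀ i, IsOpen (U i)) (m : ℕ) (_ : 0 < m)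
    (_ : ∀ x, {i | x ∈ U i}.encard ≤ m), (m : ℝ≥0∞)⁻¹ * ∑' i, glbVol F n (U i)

/-! ### Cubical spaces -/

/-- An `n`-cubical space: `n` pairs of disjoint closed subsets, the faces. -/
structure CubicalStructure (n : ℕ) (P : Type*) [TopologicalSpace P] where
  pos : Fin n → Set P
  neg : Fin n → Set P
  isClosed_pos : ∀ i, IsClosed (pos i)
  isClosed_neg : ∀ i, IsClosed (neg i)
  disjoint : ∀ i, Disjoint (pos i) (neg i)

/-- The boundary, the union of the faces. -/
def CubicalStructure.boundary {n : ℕ} {P : Type*} [TopologicalSpace P]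
    (Q : CubicalStructure n P) : Set P :=
  ⋃ i, Q.pos i ∪ Q.neg i

/-- The cube `[0,1]ⁿ` with its `(n-1)`-faces. -/
def standardCube (n : ℕ) : CubicalStructure n (Fin n → unitInterval) where
  pos i := {y | y i = 1}
  neg i := {y | y i = 0}
  isClosed_pos i := isClosed_eq (continuous_apply i) continuous_const
  isClosed_neg i := isClosed_eq (continuous_apply i) continuous_const
  disjoint i := Set.disjoint_left.2 fun y (h1 : y i = 1) (h0 : y i = 0) =>
    zero_ne_one (h0.symm.trans h1)

/-- A face map: a continuous map to the cube that sends faces to the corresponding faces. -/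
structure FaceMap {n : ℕ} {P : Type*} [TopologicalSpace P] (Q : CubicalStructure n P)
    extends C(P, Fin n → unitInterval) where
  mapsTo_pos : ∀ i, MapsTo toFun (Q.pos i) ((standardCube n).pos i)
  mapsTo_neg : ∀ i, MapsTo toFun (Q.neg i) ((standardCube n).neg i)

theorem FaceMap.mapsTo_boundary {n : ℕ} {P : Type*} [TopologicalSpace P]
    {Q : CubicalStructure n P} (π : FaceMap Q) :
    MapsTo π.toContinuousMap Q.boundary (standardCube n).boundary := by
  intro x hx
  obtain ⟨i, hi⟩ := mem_iUnion.1 hx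
  exact mem_iUnion.2 ⟨i, hi.imp (fun h => π.mapsTo_pos i h) (fun h => π.mapsTo_neg i h)⟩

/-- The distance between two subsets, the infimum of the distances of their points. -/
def setDist {P : Type*} [PseudoEMetricSpace P] (A B : Set P) : ℝ≥0∞ :=
  ⨅ (x ∈ A) (y ∈ B), edist x y

end

/-! The witness is `f x = (min (dist (x, -Q i)) (d i))_i`, where `d i` is the distance between the
faces `Q i` and `-Q i`. It remains to see that `f` competes in the definition of `glbVol` and that
every interior point of the box `∏ [0, d i]` is stable for `f`; the whole space, taken as a single
open set with `m = 1`, then gives the bound.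

Competing: the coordinates of `f` are 1-Lipschitz, so the coordinate axial partition bounds its
dilation by `√n` (`minTildeDil_le_of_coord`). This is enough because the identity of `ℝⁿ` cannot do
better than `√n` (`sqrt_le_minTildeDil_id`). Indeed, every axial partition has mass `n` by taking
traces. If `g` lifts the identity, pair `∫ a_q (g_q y) dμ = y` with `y` and integrate over the unit
ball: since `∫ ⟪y, e⟫ g_q ≤ Lip(g_q) ∫ ⟪y, e⟫²` for unit `e`, this yields `n ≤ ∫ Lip(g_q) dμ`, and
then `2K ≤ K² + 1` yields `n ≤ ∫ Lip(g_q)² dμ`.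

Stability: let `V` be a neighbourhood of `y` whose closure is in the open box. Blowing up a small
cube around `y` inside `V` gives a map `b` to `□` that sends everything off the interior of `V` to
`∂□`. On each face of the space `b ∘ f` and the face map take values in the same face of `□`, so the
affine homotopy is a homotopy of pairs and `b ∘ f` is cohomologically nontrivial
(`cechPull_sub_mem_of_commonFace`). By excision (`cechPull_mem_cechCoboundaries_of_excision`) it is
already nontrivial over `V`, where it factors through `f`.

Both topological facts are proved on cochains. Compactness of the target replaces a Čech cocycle by
one defined on all sufficiently small simplices (`exists_isUniformCocycle`); uniformly close maps,
continuous or not, are then contiguous, and the prism operator compares them. -/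

/-! ### The prism operator -/

/-- The `i`-th simplex `(u x₀, …, u xᵢ, v xᵢ, …, v xₙ)` of the prism over the simplex `x`. -/
def prismSimplex {X Y : Type*} (u v : X → Y) {n : ℕ} (i : Fin (n + 1)) (x : Fin (n + 1) → X) :
    Fin (n + 2) → Y :=
  fun k => if k ≤ i.castSucc then u (x (i.predAbove k)) else v (x (i.predAbove k))

/-- The prism operator between the cochain maps induced by `u` and `v`. -/
def prism {X Y F : Type*} [AddCommGroup F] (u v : X → Y) {n : ℕ} (φ : CechCochain Y F (n + 1)) :
    CechCochain X F n :=
  fun x => ∑ i : Fin (n + 1), (-1 : ℤ) ^ (i : ℕ) • φ (prismSimplex u v i x)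

/-- The simplices `(u x₀, …, u xₘ₋₁, v xₘ, …, v xₙ)` between two consecutive prism simplices. -/
def mixSimplex {X Y : Type*} (u v : X → Y) {n : ℕ} (m : Fin (n + 2)) (x : Fin (n + 1) → X) :
    Fin (n + 1) → Y :=
  fun k => if k.castSucc < m then u (x k) else v (x k)

theorem Fin.val_predAbove_eq_ite {n : ℕ} (i : Fin n) (k : Fin (n + 1)) :
    (i.predAbove k : ℕ) = if (i : ℕ) < k then (k : ℕ) - 1 else k := by
  simp only [Fin.predAbove, Fin.lt_def, Fin.val_castSucc]
  split_ifs <;> simp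

theorem Fin.val_succAbove_eq_ite {n : ℕ} (j : Fin (n + 1)) (k : Fin n) :
    (j.succAbove k : ℕ) = if (k : ℕ) < j then (k : ℕ) else k + 1 := by
  simp only [Fin.succAbove, Fin.lt_def, Fin.val_castSucc]
  split_ifs <;> simp

theorem prismSimplex_castSucc {X Y : Type*} (u v : X → Y) {n : ℕ} (i : Fin (n + 1))
    (x : Fin (n + 1) → X) :
    (fun k => prismSimplex u v i x (i.castSucc.succAbove k)) = mixSimplex u v i.castSucc x := by
  funext k
  have key : i.predAbove (i.castSucc.succAbove k) = k := by
    ext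
    simp only [Fin.val_predAbove_eq_ite, Fin.val_succAbove_eq_ite, Fin.val_castSucc]
    split_ifs <;> omega
  have key' : i.castSucc.succAbove k ≤ i.castSucc ↔ k.castSucc < i.castSucc := by
    simp only [Fin.val_succAbove_eq_ite, Fin.lt_def, Fin.le_def, Fin.val_castSucc]
    split_ifs <;> omega
  simp only [prismSimplex, mixSimplex, key, key']

theorem prismSimplex_succ {X Y : Type*} (u v : X → Y) {n : ℕ} (i : Fin (n + 1))
    (x : Fin (n + 1) → X) :
    (fun k => prismSimplex u v i x (i.succ.succAbove k)) = mixSimplex u v i.succ x := by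
  funext k
  have key : i.predAbove (i.succ.succAbove k) = k := by
    ext
    simp only [Fin.val_predAbove_eq_ite, Fin.val_succAbove_eq_ite, Fin.val_succ]
    split_ifs <;> omega
  have key' : i.succ.succAbove k ≤ i.castSucc ↔ k.castSucc < i.succ := by
    simp only [Fin.val_succAbove_eq_ite, Fin.lt_def, Fin.le_def, Fin.val_castSucc, Fin.val_succ]
    split_ifs <;> omega
  simp only [prismSimplex, mixSimplex, key, key']

/-- Vertex `j` of `x` sits in the prism simplex at position `j` or `j + 1`, according as it comes
before or after the doubled vertex; these are the faces that cancel against the prisms over the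
faces of `x`. -/
theorem prismSimplex_succAbove {X Y : Type*} (u v : X → Y) {n : ℕ} (j : Fin (n + 2))
    (i : Fin (n + 1)) (x : Fin (n + 2) → X) :
    (fun k => prismSimplex u v (j.succAbove i) x
      (((j.succAbove i).castSucc.succAbove j).succAbove k)) =
      prismSimplex u v i (fun k => x (j.succAbove k)) := by
  funext k
  have key : (j.succAbove i).predAbove (((j.succAbove i).castSucc.succAbove j).succAbove k) =
      j.succAbove (i.predAbove k) := by
    ext
    simp only [Fin.val_predAbove_eq_ite, Fin.val_succAbove_eq_ite, Fin.val_castSucc]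
    split_ifs <;> omega
  have key' : (((j.succAbove i).castSucc.succAbove j).succAbove k ≤ (j.succAbove i).castSucc) ↔
      k ≤ i.castSucc := by
    simp only [Fin.le_def, Fin.val_succAbove_eq_ite, Fin.val_castSucc]
    split_ifs <;> omega
  simp only [prismSimplex, key, key']

theorem neg_one_pow_succAbove {n : ℕ} (j : Fin (n + 2)) (i : Fin (n + 1)) :
    (-1 : ℤ) ^ ((j.succAbove i : Fin (n + 2)) : ℕ) *
      (-1 : ℤ) ^ (((j.succAbove i).castSucc.succAbove j : Fin (n + 3)) : ℕ) =
      -((-1 : ℤ) ^ (j : ℕ) * (-1 : ℤ) ^ (i : ℕ)) := by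
  rcases lt_or_ge i.castSucc j with h | h
  · rw [Fin.succAbove_of_castSucc_lt _ _ h, Fin.succAbove_of_le_castSucc _ _ (by simpa using h.le)]
    simp [pow_succ]; ring
  · rw [Fin.succAbove_of_le_castSucc _ _ h, Fin.succAbove_of_castSucc_lt _ _
      (by simp only [Fin.lt_def, Fin.le_def, Fin.val_castSucc, Fin.val_succ] at *; omega)]
    simp [pow_succ]; ring

/-- Separates the faces that delete one of the two copies of the doubled vertex, which telescope,
from those that delete another vertex, reindexed so that the deleted vertex `j` is the outer
variable. -/
theorem sum_offDiag {F : Type*} [AddCommGroup F] {n : ℕ} (a : Fin (n + 1) → Fin (n + 2) → F) :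
    ∑ i, ∑ j, a i j = ∑ i, (a i i.castSucc + a i i.succ) +
      ∑ j : Fin (n + 1), ∑ i : Fin n,
        a (j.succAbove i) ((j.succAbove i).castSucc.succAbove j) := by
  have h1 : ∀ i, ∑ j, a i j = a i i.castSucc + ∑ j, a i (i.castSucc.succAbove j) := fun i =>
    Fin.sum_univ_succAbove _ _
  have h2 : ∀ j : Fin (n + 1), ∑ i, a i (i.castSucc.succAbove j) = a j j.succ +
      ∑ i : Fin n, a (j.succAbove i) ((j.succAbove i).castSucc.succAbove j) := fun j => by
    rw [Fin.sum_univ_succAbove _ j, Fin.succAbove_castSucc_self]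
  simp_rw [h1, Finset.sum_add_distrib]
  rw [Finset.sum_comm]
  simp_rw [h2, Finset.sum_add_distrib]
  abel

theorem sum_castSucc_sub_succ {F : Type*} [AddCommGroup F] {n : ℕ} (s : Fin (n + 2) → F) :
    ∑ i : Fin (n + 1), (s i.castSucc + -s i.succ) = s 0 - s (Fin.last _) := by
  have h1 := Fin.sum_univ_succ s
  have h2 := Fin.sum_univ_castSucc s
  rw [Finset.sum_add_distrib, Finset.sum_neg_distrib]
  rw [h1] at h2
  rw [← sub_eq_add_neg, sub_eq_sub_iff_add_eq_add, ← h2]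

theorem prism_cechDelta {X Y F : Type*} [AddCommGroup F] (u v : X → Y) {n : ℕ}
    (φ : CechCochain Y F (n + 1)) (x : Fin (n + 2) → X) :
    prism u v (cechDelta φ) x + cechDelta (prism u v φ) x =
      φ (fun i => v (x i)) - φ (fun i => u (x i)) := by
  have e1 : prism u v (cechDelta φ) x = ∑ i : Fin (n + 2), ∑ j : Fin (n + 3),
      ((-1 : ℤ) ^ (i : ℕ) * (-1 : ℤ) ^ (j : ℕ)) •
        φ (fun k => prismSimplex u v i x (j.succAbove k)) := by
    simp only [prism, cechDelta, Finset.smul_sum, mul_smul]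
  have e2 : cechDelta (prism u v φ) x = ∑ j : Fin (n + 2), ∑ i : Fin (n + 1),
      ((-1 : ℤ) ^ (j : ℕ) * (-1 : ℤ) ^ (i : ℕ)) •
        φ (prismSimplex u v i (fun k => x (j.succAbove k))) := by
    simp only [prism, cechDelta, Finset.smul_sum, mul_smul]
  rw [e1, sum_offDiag, e2]
  simp_rw [prismSimplex_succAbove, prismSimplex_castSucc, prismSimplex_succ,
    neg_one_pow_succAbove, neg_smul, Finset.sum_neg_distrib]
  have e3 : ∀ i : Fin (n + 2), ((-1 : ℤ) ^ (i : ℕ) * (-1 : ℤ) ^ (i.castSucc : ℕ)) = 1 := fun i => by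
    rw [Fin.val_castSucc, ← mul_pow]; simp
  have e4 : ∀ i : Fin (n + 2), ((-1 : ℤ) ^ (i : ℕ) * (-1 : ℤ) ^ (i.succ : ℕ)) = -1 := fun i => by
    rw [Fin.val_succ, pow_succ, ← mul_assoc, ← mul_pow]; simp
  simp_rw [e3, e4, neg_smul, one_smul]
  rw [sum_castSucc_sub_succ (fun m => φ (mixSimplex u v m x)), add_assoc, neg_add_cancel, add_zero]
  congr 2
  funext k
  simp [mixSimplex, Fin.castSucc_lt_last]

theorem cechDelta_zero_apply {Y F : Type*} [AddCommGroup F] (φ : CechCochain Y F 0)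
    (y : Fin 2 → Y) : cechDelta φ y = φ (fun _ => y 1) - φ (fun _ => y 0) := by
  rw [cechDelta, Fin.sum_univ_succ, Fin.sum_univ_one, sub_eq_add_neg]
  congr 1
  · simp only [Fin.val_zero, pow_zero, one_smul]
    congr 1; funext j; fin_cases j; rfl
  · simp only [Fin.val_succ, Fin.val_zero, zero_add, pow_one, neg_smul, one_smul]
    congr 2; funext j; fin_cases j; rfl

/-! ### Vanishing of induced maps, contiguity, uniform cocycles -/

theorem cechMap_ne_zero_iff {X Y : Type*} [TopologicalSpace X] [TopologicalSpace Y]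
    {A : Set X} {B : Set Y} (F : Type*) [AddCommGroup F] (n : ℕ) (f : C(X, Y))
    (hf : MapsTo f A B) :
    cechMap F n f hf ≠ 0 ↔
      ∃ φ ∈ cechCocycles Y B F n, cechPull F n f φ ∉ cechCoboundaries X A F n := by
  have key : ∀ φ : cechCocycles Y B F n, cechMap F n f hf (QuotientAddGroup.mk φ) = 0 ↔
      cechPull F n f φ ∈ cechCoboundaries X A F n := fun φ => by
    change QuotientAddGroup.mk _ = (0 : CechH X A F n) ↔ _
    rw [QuotientAddGroup.eq_zero_iff, AddSubgroup.mem_addSubgroupOf]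
    rfl
  constructor
  · intro h
    obtain ⟨a, ha⟩ := DFunLike.ne_iff.1 h
    obtain ⟨φ, rfl⟩ := QuotientAddGroup.mk_surjective a
    exact ⟨φ, φ.2, fun h' => ha ((key φ).2 h')⟩
  · rintro ⟨φ, h1, h2⟩ h
    exact h2 ((key ⟨φ, h1⟩).1 (by rw [h]; rfl))

theorem range_prismSimplex_subset {X Y : Type*} (u v : X → Y) {n : ℕ} (i : Fin (n + 1))
    (x : Fin (n + 1) → X) : range (prismSimplex u v i x) ⊆ u '' range x ∪ v '' range x := by
  rintro _ ⟨k, rfl⟩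
  simp only [prismSimplex]
  split_ifs
  · exact Or.inl ⟨_, ⟨_, rfl⟩, rfl⟩
  · exact Or.inr ⟨_, ⟨_, rfl⟩, rfl⟩

/-- Contiguous maps induce cohomologous cochains; `p` and `q` are the simplices of `Y` and of the
subcomplex. -/
theorem cechPull_sub_mem_of_contiguous {X Y F : Type*} [TopologicalSpace X] [AddCommGroup F]
    {A : Set X} {n : ℕ} (u v : X → Y) (φ : CechCochain Y F n) (p q : Set Y → Prop)
    (hp : ∀ ⦃s t⦄, s ⊆ t → p t → p s) (hq : ∀ ⦃s t⦄, s ⊆ t → q t → q s)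
    (hφ : ∀ y : Fin (n + 1) → Y, q (range y) → φ y = 0)
    (hdφ : ∀ y : Fin (n + 2) → Y, p (range y) → cechDelta φ y = 0) (U : PointCover X)
    (hU : ∀ (s : Set X) (z : X), (∀ x ∈ s, z ∈ U.toFun x) → p (u '' s ∪ v '' s))
    (hUA : ∀ s ⊆ A, ∀ z ∈ A, (∀ x ∈ s, z ∈ U.toFun x) → q (u '' s ∪ v '' s)) :
    cechPull F n u φ - cechPull F n v φ ∈ cechCoboundaries X A F n := by
  cases n with
  | zero =>
    refine ⟨U, fun x hx => ?_⟩
    obtain ⟨-, z, -, hz⟩ := hx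
    -- In degree `0` there is no prism; the edge from `v x` to `u x` plays its role.
    have h := hdφ ![v (x 0), u (x 0)] (hp ?_ (hU (range x) z (by simpa using hz)))
    · rw [cechDelta_zero_apply] at h
      have e : x = fun _ => x 0 := by funext j; fin_cases j; rfl
      rw [e]
      exact h
    · rintro _ ⟨k, rfl⟩
      fin_cases k
      · exact Or.inr ⟨_, ⟨0, rfl⟩, rfl⟩
      · exact Or.inl ⟨_, ⟨0, rfl⟩, rfl⟩
  | succ n =>
    refine ⟨U, -prism u v φ, fun x hx => ?_, fun x hx => ?_⟩
    · obtain ⟨hA, z, hz, h⟩ := hx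
      have : prism u v φ x = 0 := Finset.sum_eq_zero fun i _ => by
        rw [hφ _ (hq (range_prismSimplex_subset u v i x) (hUA _ (range_subset_iff.2 hA) z hz
          (by simpa using h))), smul_zero]
      simp [this]
    · obtain ⟨-, z, -, h⟩ := hx
      have h0 : prism u v (cechDelta φ) x = 0 := Finset.sum_eq_zero fun i _ => by
        rw [hdφ _ (hp (range_prismSimplex_subset u v i x) (hU _ z (by simpa using h))), smul_zero]
      have := prism_cechDelta u v φ x
      rw [h0, zero_add] at this
      rw [cechDelta_neg, Pi.neg_apply, this, neg_sub]
      rfl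

/-- A relative cochain of `(Y, B)` which is a cocycle on all simplices of diameter less
than `δ`. -/
def IsUniformCocycle {Y F : Type*} [PseudoMetricSpace Y] [AddCommGroup F] (B : Set Y) (δ : ℝ)
    {n : ℕ} (α : CechCochain Y F n) : Prop :=
  (∀ y : Fin (n + 1) → Y, (∀ i j, dist (y i) (y j) < δ) → (∀ i, y i ∈ B) → α y = 0) ∧
    ∀ y : Fin (n + 2) → Y, (∀ i j, dist (y i) (y j) < δ) → cechDelta α y = 0

/-- Move each `y` to an index `r y` whose cover member contains a ball around `y` of a fixed
Lebesgue radius. Small simplices then land in the nerve, and `r` is contiguous to the identity. -/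
theorem exists_isUniformCocycle {Y F : Type*} [PseudoMetricSpace Y] [CompactSpace Y]
    [AddCommGroup F] {B : Set Y} (hB : IsClosed B) {n : ℕ} {φ : CechCochain Y F n}
    (hφ : φ ∈ cechCocycles Y B F n) :
    ∃ α : CechCochain Y F n, ∃ δ > 0, IsUniformCocycle B δ α ∧
      φ - α ∈ cechCoboundaries Y B F n := by
  obtain ⟨W, h1, h2⟩ := hφ
  obtain ⟨δ₁, hδ₁, H₁⟩ := lebesgue_number_lemma_of_metric (c := W.toFun) isCompact_univ W.isOpen
    (fun y _ => mem_iUnion.2 ⟨y, W.mem y⟩)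
  -- A second Lebesgue number, for the members indexed by `B` only, lets `r` map `B` to itself.
  obtain ⟨δ₂, hδ₂, H₂⟩ := lebesgue_number_lemma_of_metric (c := fun b : B => W.toFun b)
    hB.isCompact (fun b => W.isOpen b) (fun y hy => mem_iUnion.2 ⟨⟨y, hy⟩, W.mem y⟩)
  have H : ∀ y, ∃ z, Metric.ball y (min δ₁ δ₂) ⊆ W.toFun z ∧ (y ∈ B → z ∈ B) := by
    intro y
    by_cases hy : y ∈ B
    · obtain ⟨b, hb⟩ := H₂ y hy
      exact ⟨b, (Metric.ball_subset_ball (min_le_right _ _)).trans hb, fun _ => b.2⟩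
    · obtain ⟨b, hb⟩ := H₁ y (mem_univ y)
      exact ⟨b, (Metric.ball_subset_ball (min_le_left _ _)).trans hb, fun h => absurd h hy⟩
  choose r hr hrB using H
  have hδ : 0 < min δ₁ δ₂ := lt_min hδ₁ hδ₂
  refine ⟨cechPull F n r φ, min δ₁ δ₂, hδ, ⟨fun y hy hyB => ?_, fun y hy => ?_⟩, ?_⟩
  · exact h1 _ ⟨fun i => hrB _ (hyB i), y 0, hyB 0, fun i => hr _ (hy 0 i)⟩
  · exact h2 _ ⟨fun i => mem_univ _, y 0, mem_univ _, fun i => hr _ (hy 0 i)⟩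
  · refine cechPull_sub_mem_of_contiguous id r φ (fun s => ∃ z, ∀ y ∈ s, z ∈ W.toFun y)
      (fun s => s ⊆ B ∧ ∃ z ∈ B, ∀ y ∈ s, z ∈ W.toFun y)
      (fun s t hst ⟨z, hz⟩ => ⟨z, fun y hy => hz y (hst hy)⟩)
      (fun s t hst ⟨hB, z, hzB, hz⟩ => ⟨hst.trans hB, z, hzB, fun y hy => hz y (hst hy)⟩)
      (fun y ⟨hy, z, hz, h⟩ => h1 y ⟨fun i => hy ⟨i, rfl⟩, z, hz, fun i => h _ ⟨i, rfl⟩⟩)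
      (fun y ⟨z, h⟩ => h2 y ⟨fun i => mem_univ _, z, mem_univ _, fun i => h _ ⟨i, rfl⟩⟩)
      ⟨fun y => W.toFun y ∩ W.toFun (r y), fun y => (W.isOpen _).inter (W.isOpen _),
        fun y => ⟨W.mem y, hr y (Metric.mem_ball_self hδ)⟩⟩ ?_ ?_
    · intro s z hz
      refine ⟨z, ?_⟩
      rintro _ (⟨x, hx, rfl⟩ | ⟨x, hx, rfl⟩)
      exacts [(hz x hx).1, (hz x hx).2]
    · intro s hs z hzB hz
      refine ⟨?_, z, hzB, ?_⟩
      · rintro _ (⟨x, hx, rfl⟩ | ⟨x, hx, rfl⟩)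
        exacts [hs hx, hrB _ (hs hx)]
      · rintro _ (⟨x, hx, rfl⟩ | ⟨x, hx, rfl⟩)
        exacts [(hz x hx).1, (hz x hx).2]

/-- On a cover where `u` oscillates by less than `δ / 4`, the images under `u` and `v` together have
all mutual distances below `δ`. Only `u` need be continuous, which is what excision exploits. -/
theorem IsUniformCocycle.pull_sub_mem {X Y F : Type*} [TopologicalSpace X] [PseudoMetricSpace Y]
    [AddCommGroup F] {A : Set X} {B : Set Y} {δ : ℝ} {n : ℕ} {α : CechCochain Y F n}
    (hα : IsUniformCocycle B δ α) (hδ : 0 < δ) (u : C(X, Y)) (v : X → Y)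
    (huv : ∀ x, dist (u x) (v x) < δ / 4) (hu : MapsTo u A B) (hv : MapsTo v A B) :
    cechPull F n u α - cechPull F n v α ∈ cechCoboundaries X A F n := by
  let U : PointCover X := ⟨fun x => {z | dist (u x) (u z) < δ / 4}, fun x =>
    isOpen_lt (by fun_prop) continuous_const, fun x => by simpa using hδ⟩
  have hU : ∀ (s : Set X) (z : X), (∀ x ∈ s, z ∈ U.toFun x) →
      ∀ a ∈ u '' s ∪ v '' s, ∀ b ∈ u '' s ∪ v '' s, dist a b < δ := by
    intro s z hz
    have hd : ∀ a ∈ u '' s ∪ v '' s, dist a (u z) < δ / 2 := by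
      rintro _ (⟨x, hx, rfl⟩ | ⟨x, hx, rfl⟩)
      · have : dist (u x) (u z) < δ / 4 := hz x hx
        linarith
      · have h1 : dist (u x) (u z) < δ / 4 := hz x hx
        have h2 := huv x
        have := dist_triangle_left (v x) (u z) (u x)
        linarith
    intro a ha b hb
    have := dist_triangle_right a b (u z)
    linarith [hd a ha, hd b hb]
  refine cechPull_sub_mem_of_contiguous u v α (fun s => ∀ a ∈ s, ∀ b ∈ s, dist a b < δ)
    (fun s => s ⊆ B ∧ ∀ a ∈ s, ∀ b ∈ s, dist a b < δ)
    (fun s t hst h a ha b hb => h a (hst ha) b (hst hb))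
    (fun s t hst ⟨h', h⟩ => ⟨hst.trans h', fun a ha b hb => h a (hst ha) b (hst hb)⟩)
    (fun y ⟨h', h⟩ => hα.1 y (fun i j => h _ ⟨i, rfl⟩ _ ⟨j, rfl⟩) fun i => h' ⟨i, rfl⟩)
    (fun y h => hα.2 y (fun i j => h _ ⟨i, rfl⟩ _ ⟨j, rfl⟩)) U hU
    (fun s hs z _ hz => ⟨?_, hU s z hz⟩)
  rintro _ (⟨x, hx, rfl⟩ | ⟨x, hx, rfl⟩)
  exacts [hu (hs hx), hv (hs hx)]

theorem mem_cechCoboundaries_of_forall_eq_zero {X F : Type*} [TopologicalSpace X]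
    [AddCommGroup F] {A : Set X} {n : ℕ} {φ : CechCochain X F n} (U : PointCover X)
    (h : ∀ x ∈ U.nerve univ n, φ x = 0) : φ ∈ cechCoboundaries X A F n := by
  cases n with
  | zero => exact ⟨U, h⟩
  | succ n => exact ⟨U, 0, fun _ _ => rfl, fun x hx => by rw [cechDelta_zero, h x hx]; rfl⟩

/-- A map of pairs into `(B, B)` induces zero. -/
theorem cechPull_mem_cechCoboundaries_of_range_subset {X Y F : Type*} [TopologicalSpace X]
    [TopologicalSpace Y] [AddCommGroup F] {A : Set X} {B : Set Y} {n : ℕ} {φ : CechCochain Y F n}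
    (hφ : φ ∈ cechCocycles Y B F n) (f : C(X, Y)) (hf : ∀ x, f x ∈ B) :
    cechPull F n f φ ∈ cechCoboundaries X A F n := by
  obtain ⟨W, h1, -⟩ := hφ
  exact mem_cechCoboundaries_of_forall_eq_zero (W.pullback f) fun x ⟨_, z, _, h⟩ =>
    h1 _ ⟨fun i => hf _, f z, hf z, h⟩

/-! ### Homotopy invariance for maps to the cube -/

theorem CubicalStructure.isClosed_boundary {n : ℕ} {P : Type*} [TopologicalSpace P]
    (Q : CubicalStructure n P) : IsClosed Q.boundary :=
  isClosed_iUnion_of_finite fun i => (Q.isClosed_pos i).union (Q.isClosed_neg i)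

/-- The affine homotopy between two maps to the cube. -/
def cubeHomotopy {X : Type*} [TopologicalSpace X] {n : ℕ} (u v : C(X, Fin n → unitInterval))
    (t : unitInterval) : C(X, Fin n → unitInterval) where
  toFun x i := ⟨(1 - t) * u x i + t * v x i, by
    have ht := t.2; have hu := (u x i).2; have hv := (v x i).2
    constructor
    · nlinarith [mul_nonneg (sub_nonneg.2 ht.2) hu.1, mul_nonneg ht.1 hv.1]
    · nlinarith [mul_nonneg (sub_nonneg.2 ht.2) (sub_nonneg.2 hu.2),
        mul_nonneg ht.1 (sub_nonneg.2 hv.2)]⟩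
  continuous_toFun := by fun_prop

theorem dist_cubeHomotopy_le {X : Type*} [TopologicalSpace X] {n : ℕ}
    (u v : C(X, Fin n → unitInterval)) (s t : unitInterval) (x : X) :
    dist (cubeHomotopy u v s x) (cubeHomotopy u v t x) ≤ dist s t := by
  refine (dist_pi_le_iff dist_nonneg).2 fun i => ?_
  rw [Subtype.dist_eq, Subtype.dist_eq, Real.dist_eq, Real.dist_eq]
  have h : ((cubeHomotopy u v s x i : unitInterval) : ℝ) - cubeHomotopy u v t x i =
      ((s : ℝ) - t) * ((v x i : ℝ) - u x i) := by
    simp only [cubeHomotopy, ContinuousMap.coe_mk]; ring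
  rw [h, abs_mul]
  refine mul_le_of_le_one_right (abs_nonneg _) (abs_le.2 ⟨?_, ?_⟩) <;>
    linarith [(v x i).2.1, (v x i).2.2, (u x i).2.1, (u x i).2.2]

/-- The affine homotopy keeps the shared face coordinate constant, hence maps `A` to `∂□` at all
times. It is cut into time steps short enough for consecutive stages to be `δ / 4`-close. -/
theorem cechPull_sub_mem_of_commonFace {X F : Type*} [TopologicalSpace X] [AddCommGroup F]
    {A : Set X} {n m : ℕ} (u v : C(X, Fin n → unitInterval))
    (h : ∀ x ∈ A, ∃ i, (u x i = 1 ∧ v x i = 1) ∨ (u x i = 0 ∧ v x i = 0))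
    {φ : CechCochain (Fin n → unitInterval) F m}
    (hφ : φ ∈ cechCocycles _ (standardCube n).boundary F m) :
    cechPull F m u φ - cechPull F m v φ ∈ cechCoboundaries X A F m := by
  have hB := (standardCube n).isClosed_boundary
  obtain ⟨α, δ, hδ, hα, hαφ⟩ := exists_isUniformCocycle hB hφ
  have hmem : ∀ t, MapsTo (cubeHomotopy u v t) A (standardCube n).boundary := fun t x hx => by
    obtain ⟨i, hi⟩ := h x hx
    refine mem_iUnion.2 ⟨i, hi.imp (fun hi => ?_) (fun hi => ?_)⟩ <;>
      · change cubeHomotopy u v t x i = _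
        ext
        simp [cubeHomotopy, hi.1, hi.2]
  have h0 : cubeHomotopy u v 0 = u := by ext; simp [cubeHomotopy]
  have h1 : cubeHomotopy u v 1 = v := by ext; simp [cubeHomotopy]
  obtain ⟨N, hN⟩ := exists_nat_one_div_lt (div_pos hδ four_pos)
  let t : ℕ → unitInterval := fun k => Set.projIcc 0 1 zero_le_one ((k : ℝ) / (N + 1))
  have ht : ∀ k, dist (t k) (t (k + 1)) < δ / 4 := fun k => by
    refine lt_of_le_of_lt ?_ hN
    have := abs_projIcc_sub_projIcc (h := zero_le_one (α := ℝ)) (c := (k : ℝ) / (N + 1))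
      (d := ((k + 1 : ℕ) : ℝ) / (N + 1))
    refine this.trans (le_of_eq ?_)
    rw [← sub_div]
    push_cast
    rw [sub_add_cancel_left, abs_div, abs_neg, abs_one, abs_of_pos (by positivity)]
  have step : ∀ k, cechPull F m (cubeHomotopy u v (t 0)) α - cechPull F m (cubeHomotopy u v (t k)) α
      ∈ cechCoboundaries X A F m := by
    intro k
    induction k with
    | zero => rw [sub_self]; exact zero_mem _
    | succ k ih =>
      rw [← sub_add_sub_cancel]
      exact add_mem ih (hα.pull_sub_mem hδ _ _
        (fun x => (dist_cubeHomotopy_le u v _ _ x).trans_lt (ht k)) (hmem _) (hmem _))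
  have ht0 : t 0 = 0 := by simp [t]
  have ht1 : t (N + 1) = 1 := by
    simp only [t]
    rw [Nat.cast_add_one, div_self (by positivity)]
    exact Set.projIcc_right (zero_le_one' ℝ)
  have hs := step (N + 1)
  rw [ht0, ht1, h0, h1] at hs
  have hu : cechPull F m u (φ - α) ∈ cechCoboundaries X A F m :=
    cechPull_coboundaries F m u (h0 ▸ hmem 0) hαφ
  have hv : cechPull F m v (φ - α) ∈ cechCoboundaries X A F m :=
    cechPull_coboundaries F m v (h1 ▸ hmem 1) hαφ
  rw [map_sub] at hu hv
  convert sub_mem (add_mem hu hs) hv using 1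
  abel

/-! ### Excision -/

/-- Strong excision for the pairs `(X, X \ (C \ A))` and `(C, A)`: a map to `(Y, B)` which is trivial on `(C, A)` is trivial on `X`, relative to any set off `C`. -/
theorem cechPull_mem_cechCoboundaries_of_excision {X Y F : Type*} [PseudoMetricSpace X]
    [PseudoMetricSpace Y] [CompactSpace Y] [AddCommGroup F] {B : Set Y} (hB : IsClosed B)
    (g : C(X, Y)) {C A T : Set X} (hC : IsClosed C) (hCA : IsOpen (C \ A)) (hAC : A ⊆ C)
    (hTC : Disjoint T C) (hg : ∀ x ∉ C \ A, g x ∈ B) {n : ℕ} {φ : CechCochain Y F n}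
    (hφ : φ ∈ cechCocycles Y B F n)
    (h : cechPull F n (fun x : C => g x) φ ∈ cechCoboundaries C {x : C | (x : X) ∈ A} F n) :
    cechPull F n g φ ∈ cechCoboundaries X T F n := by
  obtain ⟨α, δ, hδ, hα, hαφ⟩ := exists_isUniformCocycle hB hφ
  have hgA : ∀ x ∈ A, g x ∈ B := fun x hx => hg x fun h => h.2 hx
  have hgC : ∀ x ∉ C, g x ∈ B := fun x hx => hg x fun h => hx h.1
  have hgT : MapsTo g T B := fun x hx => hgC x (disjoint_left.1 hTC hx)
  let gC : C(C, Y) := g.comp ⟨Subtype.val, continuous_subtype_val⟩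
  have hr1 : cechPull F n g (φ - α) ∈ cechCoboundaries X T F n :=
    cechPull_coboundaries F n g hgT hαφ
  have hr2 : cechPull F n gC (φ - α) ∈ cechCoboundaries C {x : C | (x : X) ∈ A} F n :=
    cechPull_coboundaries F n gC (fun x hx => hgA x hx) hαφ
  rw [map_sub] at hr1 hr2
  suffices hs : cechPull F n g α ∈ cechCoboundaries X T F n by
    simpa using add_mem hr1 hs
  replace h : cechPull F n gC α ∈ cechCoboundaries C {x : C | (x : X) ∈ A} F n := by
    have h' := sub_mem (show cechPull F n gC φ ∈ _ from h) hr2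
    rwa [sub_sub_cancel] at h'
  cases n with
  | zero =>
    obtain ⟨U, hU⟩ := h
    refine ⟨PointCover.top X, fun x _ => ?_⟩
    have hx0 : ∀ i, x i = x 0 := fun i => by fin_cases i; rfl
    by_cases hx : x 0 ∈ C
    · have := hU (fun _ => ⟨x 0, hx⟩) ⟨fun _ => mem_univ _, ⟨x 0, hx⟩, mem_univ _, fun _ => U.mem _⟩
      rwa [show x = fun _ => x 0 from funext hx0]
    · refine hα.1 _ (fun j k => ?_) fun j => ?_
      · simpa [hx0 j, hx0 k] using hδ
      · rw [hx0 j]; exact hgC _ hx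
  | succ n =>
    obtain ⟨U, ψ, hψA, hψ⟩ := h
    have hε : ∀ a : C, ∃ ε > 0, (∀ x : C, dist (x : X) a < ε → x ∈ U.toFun a) ∧
        ∀ x, dist x (a : X) < ε → dist (g x) (g a) < δ / 4 := by
      intro a
      obtain ⟨ε₁, h1, H1⟩ := Metric.isOpen_iff.1 (U.isOpen a) a (U.mem a)
      obtain ⟨ε₂, h2, H2⟩ := Metric.continuous_iff.1 g.continuous a (δ / 4) (by positivity)
      exact ⟨min ε₁ ε₂, lt_min h1 h2, fun x hx => H1 (hx.trans_le (min_le_left _ _)),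
        fun x hx => H2 x (hx.trans_le (min_le_right _ _))⟩
    choose ε hε0 hεU hεg using hε
    -- `C` is thickened only along `A`, since `C \ A` is already open. The cochain `ψ` will be
    -- extended to `C ∪ N` along a possibly discontinuous `ρ` to `C` that takes `N` to `A`.
    let N : Set X := {x | ∃ a : C, (a : X) ∈ A ∧ dist x a < ε a / 4}
    have hAN : A ⊆ N := fun a ha => ⟨⟨a, hAC ha⟩, ha, by
      simpa using hε0 ⟨a, hAC ha⟩⟩
    let D : Set X := C ∪ N
    have hρ : ∀ x, x ∈ D → ∃ c : C, dist x c < ε c / 4 ∧ (x ∈ N → (c : X) ∈ A) := by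
      intro x hx
      by_cases hN : x ∈ N
      · obtain ⟨a, ha, hd⟩ := hN
        exact ⟨a, hd, fun _ => ha⟩
      · have hxC : x ∈ C := hx.resolve_right hN
        exact ⟨⟨x, hxC⟩, by simpa using hε0 ⟨x, hxC⟩, fun h => absurd h hN⟩
    choose ρ hρd hρA using hρ
    -- The cover keeps points of `D \ N` inside `C` and points outside `D` away from `C`, so no
    -- simplex has vertices of both kinds.
    have hO : ∀ x, ∃ O : Set X, IsOpen O ∧ x ∈ O ∧
        (∀ hD : x ∈ D, ∀ z ∈ O, dist z (ρ x hD) < ε (ρ x hD) / 4) ∧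
        (x ∈ D → x ∉ N → O ⊆ C) ∧ (x ∉ D → O ⊆ Cᶜ) ∧ ∀ z ∈ O, dist (g z) (g x) < δ / 4 := by
      intro x
      have hgo : IsOpen {z | dist (g z) (g x) < δ / 4} :=
        isOpen_lt (by fun_prop) continuous_const
      have hgx : x ∈ {z | dist (g z) (g x) < δ / 4} := by simpa using hδ
      by_cases hD : x ∈ D
      · have hbo : IsOpen {z | dist z (ρ x hD : X) < ε (ρ x hD) / 4} :=
          isOpen_lt (by fun_prop) continuous_const
        by_cases hN : x ∈ N
        · exact ⟨_ ∩ _, hbo.inter hgo, ⟨hρd x hD, hgx⟩, fun _ z hz => hz.1,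
            fun _ h => absurd hN h, fun h => absurd hD h, fun z hz => hz.2⟩
        · exact ⟨_ ∩ _ ∩ _, (hbo.inter hgo).inter hCA, ⟨⟨hρd x hD, hgx⟩,
            hD.resolve_right hN, fun h => hN (hAN h)⟩, fun _ z hz => hz.1.1,
            fun _ _ z hz => hz.2.1, fun h => absurd hD h, fun z hz => hz.1.2⟩
      · exact ⟨_ ∩ _, hC.isOpen_compl.inter hgo, ⟨fun h => hD (Or.inl h), hgx⟩,
          fun h => absurd h hD, fun h => absurd h hD, fun _ z hz => hz.1, fun z hz => hz.2⟩
    choose O hOo hOm hOρ hOC hOD hOg using hO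
    let 𝒰 : PointCover X := ⟨O, hOo, hOm⟩
    have nerveA : ∀ {m : ℕ} (x : Fin (m + 1) → X) (z : X) (_ : ∀ i, z ∈ O (x i))
        (hD : ∀ i, x i ∈ D) (_ : ∀ i, x i ∈ N),
        (fun i => ρ (x i) (hD i)) ∈ U.nerve {x : C | (x : X) ∈ A} m := by
      intro m x z hz hD hN
      -- The point `z` may lie off `C`. The centre of smallest radius serves as common point
      -- instead: it is within `ε i / 4 + ε k / 4 < ε i` of every other centre.
      obtain ⟨k, hk⟩ := Finite.exists_min fun i => ε (ρ (x i) (hD i))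
      refine ⟨fun i => hρA _ _ (hN i), ρ (x k) (hD k), hρA _ _ (hN k), fun i => hεU _ _ ?_⟩
      have h1 := hOρ _ (hD i) z (hz i)
      have h2 := hOρ _ (hD k) z (hz k)
      have h3 := hk i
      have h4 := hε0 (ρ (x i) (hD i))
      have := dist_triangle_left (ρ (x k) (hD k) : X) (ρ (x i) (hD i)) z
      linarith
    have memN : ∀ x, x ∈ D → ∀ z ∈ O x, z ∉ C → x ∈ N := fun x hx z hz hzC => by
      by_contra hN
      exact hzC (hOC x hx hN hz)
    have nerveU : ∀ {m : ℕ} (x : Fin (m + 1) → X) (z : X) (_ : ∀ i, z ∈ O (x i))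
        (hD : ∀ i, x i ∈ D), (fun i => ρ (x i) (hD i)) ∈ U.nerve univ m := by
      intro m x z hz hD
      by_cases hzC : z ∈ C
      · refine ⟨fun _ => mem_univ _, ⟨z, hzC⟩, mem_univ _, fun i => hεU _ _ ?_⟩
        exact (hOρ _ (hD i) z (hz i)).trans (by linarith [hε0 (ρ (x i) (hD i))])
      · obtain ⟨-, w, -, hw⟩ := nerveA x z hz hD fun i => memN _ (hD i) z (hz i) hzC
        exact ⟨fun _ => mem_univ _, w, mem_univ _, hw⟩
    classical
    let r : X → X := fun x => if hx : x ∈ D then ρ x hx else x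
    have hr : ∀ x (hx : x ∈ D), r x = ρ x hx := fun x hx => dif_pos hx
    have hr' : ∀ x, x ∉ D → r x = x := fun x hx => dif_neg hx
    let ψ' : CechCochain X F n := fun x =>
      if hx : ∀ i, x i ∈ D then ψ fun i => ρ (x i) (hx i) else 0
    have hψ'N : ∀ (x : Fin (n + 1) → X) (z : X), (∀ i, z ∈ O (x i)) →
        (∀ i, x i ∈ D → x i ∈ N) → ψ' x = 0 := by
      intro x z hz hN
      by_cases hD : ∀ i, x i ∈ D
      · exact (dif_pos hD).trans (hψA _ (nerveA x z hz hD fun i => hN i (hD i)))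
      · exact dif_neg hD
    have hgr : ∀ x, dist (g x) (g (r x)) < δ / 4 := by
      intro x
      by_cases hD : x ∈ D
      · rw [hr x hD]
        exact hεg _ _ ((hρd x hD).trans (by linarith [hε0 (ρ x hD)]))
      · rw [hr' x hD]; simpa using hδ
    have hgrB : ∀ x, (x ∈ D → x ∈ N) → g (r x) ∈ B := by
      intro x hN
      by_cases hD : x ∈ D
      · rw [hr x hD]; exact hgA _ (hρA x hD (hN hD))
      · rw [hr' x hD]; exact hgC _ fun h => hD (Or.inl h)
    have hTN : ∀ x ∈ T, x ∈ D → x ∈ N := fun x hx hD =>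
      hD.resolve_left (disjoint_left.1 hTC hx)
    have main : cechPull F (n + 1) (fun x => g (r x)) α ∈ cechCoboundaries X T F (n + 1) := by
      refine ⟨𝒰, ψ', fun x ⟨hxT, z, _, hz⟩ => hψ'N x z hz fun i => hTN _ (hxT i),
        fun x ⟨_, z, _, hz⟩ => ?_⟩
      by_cases hD : ∀ i, x i ∈ D
      · have h1 := hψ _ (nerveU x z hz hD)
        have h2 : cechDelta ψ' x = cechDelta ψ fun i => ρ (x i) (hD i) := by
          refine Finset.sum_congr rfl fun i _ => ?_
          rw [show ψ' (fun j => x (i.succAbove j)) =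
            ψ fun j => ρ (x (i.succAbove j)) (hD (i.succAbove j)) from dif_pos fun j => hD _]
        rw [h2, ← h1]
        change α _ = α _
        congr 1
        funext i
        exact congrArg g (hr _ (hD i))
      -- A vertex outside `D` forces all vertices in `D` into `N`. The extended cochain vanishes on
      -- every face, and `g ∘ r` takes the vertices to `B`, where `α` vanishes too.
      · push Not at hD
        obtain ⟨k, hk⟩ := hD
        have hzC : z ∉ C := hOD _ hk (hz k)
        have hN : ∀ i, x i ∈ D → x i ∈ N := fun i hi => memN _ hi z (hz i) hzC
        have h1 : cechDelta ψ' x = 0 := Finset.sum_eq_zero fun i _ => by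
          rw [hψ'N _ z (fun j => hz _) fun j => hN _, smul_zero]
        rw [h1]
        refine hα.1 _ (fun i j => ?_) fun i => hgrB _ (hN i)
        have hd : ∀ i, dist (g z) (g (r (x i))) < δ / 2 := fun i => by
          have := dist_triangle (g z) (g (x i)) (g (r (x i)))
          linarith [hgr (x i), hOg (x i) z (hz i)]
        have := dist_triangle_left (g (r (x i))) (g (r (x j))) (g z)
        linarith [hd i, hd j]
    have := hα.pull_sub_mem (A := T) hδ g (fun x => g (r x)) hgr hgT
      fun x hx => hgrB x (hTN x hx)
    simpa using add_mem this main

/-! ### Axial partitions of unity in Euclidean spaces -/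

theorem AxialProjector.axis_eq_smul {Y : Type*} [NormedAddCommGroup Y] [NormedSpace ℝ Y]
    (q : AxialProjector Y) (t : ℝ) : q.axis t = t • q.axis 1 := by
  rw [← map_smul, smul_eq_mul, mul_one]

theorem AxialProjector.norm_axis_one {Y : Type*} [NormedAddCommGroup Y] [NormedSpace ℝ Y]
    (q : AxialProjector Y) : ‖q.axis 1‖ = 1 := by
  rw [q.axis.norm_map, norm_one]

/-- The Riesz vector of `proj` and the axis vector are unit vectors with inner product `1`, so they
coincide by the equality case of Cauchy–Schwarz. -/
theorem AxialProjector.proj_eq_inner {Y : Type*} [NormedAddCommGroup Y] [InnerProductSpace ℝ Y]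
    [CompleteSpace Y] (q : AxialProjector Y) (y : Y) : q.proj y = inner ℝ (q.axis 1) y := by
  have hw : ∀ y, inner ℝ ((InnerProductSpace.toDual ℝ Y).symm q.proj) y = q.proj y :=
    fun y => InnerProductSpace.toDual_symm_apply
  have h1 : inner ℝ ((InnerProductSpace.toDual ℝ Y).symm q.proj) (q.axis 1) = (1 : ℝ) := by
    rw [hw, q.proj_axis]
  rw [inner_eq_one_iff_of_norm_eq_one (by rw [LinearIsometryEquiv.norm_map, q.norm_proj])
    q.norm_axis_one] at h1
  rw [← hw, h1]

theorem AxialProjector.continuous_axis_one {Y : Type*} [NormedAddCommGroup Y] [NormedSpace ℝ Y] :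
    Continuous fun q : AxialProjector Y => q.axis 1 :=
  continuous_fst.comp
    (continuous_induced_dom (f := fun q : AxialProjector Y => (q.axis 1, q.proj)))

theorem IsAxialPartition.integral_inner_sq {n : ℕ} {μ : Measure (AxialProjector (EucSpace n))}
    (hμ : IsAxialPartition μ) (y : EucSpace n) :
    Integrable (fun q : AxialProjector (EucSpace n) => inner ℝ y (q.axis 1) ^ 2) μ ∧
      ∫ q, (inner ℝ y (q.axis 1) : ℝ) ^ 2 ∂μ = ‖y‖ ^ 2 := by
  obtain ⟨h1, h2⟩ := hμ y
  have e : ∀ q : AxialProjector (EucSpace n),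
      inner ℝ y (q.axis (q.proj y)) = (inner ℝ y (q.axis 1) : ℝ) ^ 2 := fun q => by
    rw [q.axis_eq_smul, q.proj_eq_inner, inner_smul_right, real_inner_comm, sq]
  refine ⟨by simpa only [e] using h1.const_inner (𝕜 := ℝ) y, ?_⟩
  have := integral_inner (𝕜 := ℝ) h1 y
  simp only [e] at this
  rw [this, h2, real_inner_self_eq_norm_sq]

/-- Trace of `∫ p dμ = id`: each projector has trace `1`, the identity has trace `n`. -/
theorem IsAxialPartition.mass {n : ℕ} {μ : Measure (AxialProjector (EucSpace n))}
    (hμ : IsAxialPartition μ) : IsFiniteMeasure μ ∧ μ.real univ = n := by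
  let b := EuclideanSpace.basisFun (Fin n) ℝ
  have e : ∀ q : AxialProjector (EucSpace n), ∑ i, (inner ℝ (b i) (q.axis 1) : ℝ) ^ 2 = 1 :=
    fun q => by
      have := b.sum_sq_norm_inner_right (q.axis 1)
      rw [q.norm_axis_one] at this
      simpa using this
  have h1 : Integrable (fun _ : AxialProjector (EucSpace n) => (1 : ℝ)) μ := by
    simpa only [e] using integrable_finsetSum Finset.univ fun i _ => (hμ.integral_inner_sq (b i)).1
  have h2 : ∫ _ : AxialProjector (EucSpace n), (1 : ℝ) ∂μ = n := by
    rw [← integral_congr_ae (ae_of_all _ e),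
      integral_finsetSum _ fun i _ => (hμ.integral_inner_sq (b i)).1]
    simp [(hμ.integral_inner_sq _).2]
  refine ⟨(integrable_const_iff.1 h1).resolve_left one_ne_zero, by simpa using h2⟩

/-- A family of Lipschitz functions which is pointwise a.e. measurable in the parameter can
be made jointly measurable. -/
theorem exists_measurable_uncurry_of_lipschitz {Ω Y : Type*} [MeasurableSpace Ω]
    [MetricSpace Y] [TopologicalSpace.SeparableSpace Y] [Nonempty Y] [MeasurableSpace Y]
    [OpensMeasurableSpace Y] {μ : Measure Ω}
    {g : Ω → Y → ℝ} {K : Ω → ℝ≥0} (hg : ∀ q, LipschitzWith (K q) (g q))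
    (hm : ∀ y, AEStronglyMeasurable (fun q => g q y) μ) :
    ∃ g' : Ω → Y → ℝ, Measurable (Function.uncurry fun y q => g' q y) ∧
      (∀ q, LipschitzWith (K q) (g' q)) ∧ ∀ᵐ q ∂μ, g' q = g q := by
  let d := TopologicalSpace.denseSeq Y
  -- Countably many values determine a continuous function, so one null set of parameters suffices;
  -- there `g` is replaced by `0`.
  have hae : ∀ᵐ q ∂μ, ∀ k, g q (d k) = (hm (d k)).mk _ q := ae_all_iff.2 fun k =>
    (hm (d k)).ae_eq_mk
  obtain ⟨S, hS, hSm, hSe⟩ := hae.exists_measurable_mem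
  classical
  let g' : Ω → Y → ℝ := fun q => if q ∈ S then g q else 0
  have hL : ∀ q, LipschitzWith (K q) (g' q) := fun q => by
    by_cases h : q ∈ S
    · simpa only [g', if_pos h] using hg q
    · simp only [g', if_neg h]; exact LipschitzWith.const' (0 : ℝ)
  have hd : ∀ k, Measurable fun q => g' q (d k) := fun k => by
    have : (fun q => g' q (d k)) = S.indicator ((hm (d k)).mk _) := by
      funext q
      by_cases h : q ∈ S
      · simp only [g', if_pos h, indicator_of_mem h]; exact hSe q h k
      · simp only [g', if_neg h, indicator_of_notMem h]; rfl
    rw [this]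
    exact (hm (d k)).stronglyMeasurable_mk.measurable.indicator hSm
  have hy : ∀ y, Measurable fun q => g' q y := fun y => by
    obtain ⟨x, hx, hlim⟩ := mem_closure_iff_seq_limit.1 (TopologicalSpace.denseRange_denseSeq Y y)
    choose k hk using hx
    refine measurable_of_tendsto_metrizable (f := fun j q => g' q (d (k j))) (fun j => hd _)
      (tendsto_pi_nhds.2 fun q => ?_)
    simp only [d, hk]
    exact ((hL q).continuous.tendsto y).comp hlim
  refine ⟨g', ?_, hL, Filter.mem_of_superset hS fun q hq => if_pos hq⟩
  exact measurable_uncurry_of_continuous_of_measurable (fun q => (hL q).continuous) hy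

/-! ### Lower bound for the dilation of the identity -/

/-- The second moment of a coordinate over the unit ball. -/
theorem setIntegral_ball_inner_sq {n : ℕ} {e : EucSpace n} (he : ‖e‖ = 1) :
    n * ∫ y in Metric.ball (0 : EucSpace n) 1, (inner ℝ y e : ℝ) ^ 2 =
      ∫ y in Metric.ball (0 : EucSpace n) 1, ‖y‖ ^ 2 := by
  have hint : ∀ e : EucSpace n, IntegrableOn (fun y => (inner ℝ y e : ℝ) ^ 2)
      (Metric.ball (0 : EucSpace n) 1) := fun e =>
    ((by fun_prop : Continuous fun y : EucSpace n => (inner ℝ y e : ℝ) ^ 2).continuousOn.integrableOn_compact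
      (isCompact_closedBall 0 1)).mono_set Metric.ball_subset_closedBall
  let b := EuclideanSpace.basisFun (Fin n) ℝ
  have hb : ∀ i, ∫ y in Metric.ball (0 : EucSpace n) 1, (inner ℝ y (b i) : ℝ) ^ 2 =
      ∫ y in Metric.ball (0 : EucSpace n) 1, (inner ℝ y e : ℝ) ^ 2 := fun i => by
    -- The reflection taking `e` to `b i` preserves the ball, so all directions have the same second
    -- moment.
    have hR := Submodule.reflection_sub (v := e) (w := b i) (by rw [he, b.norm_eq_one])
    set R := (Submodule.span ℝ {e - b i})ᗮ.reflection
    have h := R.measurePreserving.setIntegral_preimage_emb R.toMeasurableEquiv.measurableEmbedding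
      (fun y => (inner ℝ y (b i) : ℝ) ^ 2) (Metric.ball 0 1)
    have hball : R ⁻¹' Metric.ball 0 1 = Metric.ball 0 1 := by ext; simp
    rw [← h, hball]
    refine integral_congr_ae (ae_of_all _ fun y => ?_)
    simp only
    rw [← hR, R.inner_map_map]
  have e1 : ∀ y : EucSpace n, ‖y‖ ^ 2 = ∑ i, (inner ℝ y (b i) : ℝ) ^ 2 := fun y => by
    have := b.sum_sq_norm_inner_left y
    simpa using this.symm
  simp_rw [e1]
  rw [integral_finsetSum _ fun i _ => hint (b i)]
  simp [hb]

theorem setIntegral_ball_norm_sq_pos {n : ℕ} (hn : 0 < n) :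
    0 < ∫ y in Metric.ball (0 : EucSpace n) 1, ‖y‖ ^ 2 := by
  have : Nonempty (Fin n) := ⟨⟨0, hn⟩⟩
  have hint : IntegrableOn (fun y : EucSpace n => ‖y‖ ^ 2) (Metric.ball (0 : EucSpace n) 1) :=
    ((by fun_prop : Continuous fun y : EucSpace n => ‖y‖ ^ 2).continuousOn.integrableOn_compact
      (isCompact_closedBall 0 1)).mono_set Metric.ball_subset_closedBall
  rw [setIntegral_pos_iff_support_of_nonneg_ae (ae_of_all _ fun y => by positivity) hint]
  have : Function.support (fun y : EucSpace n => ‖y‖ ^ 2) = {0}ᶜ := by ext; simp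
  rw [this, ← sdiff_eq_compl_inter, measure_sdiff_null (by simp)]
  exact Metric.measure_ball_pos _ _ one_pos

/-- Integration against a coordinate picks up at most the Lipschitz constant. -/
theorem setIntegral_ball_inner_mul_le {n : ℕ} {e : EucSpace n} (he : ‖e‖ = 1)
    {g : EucSpace n → ℝ} {K : ℝ≥0} (hg : LipschitzWith K g) :
    ∫ y in Metric.ball (0 : EucSpace n) 1, (inner ℝ y e : ℝ) * g y ≤
      K * ∫ y in Metric.ball (0 : EucSpace n) 1, (inner ℝ y e : ℝ) ^ 2 := by
  have hcont := hg.continuous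
  have hint : ∀ f : EucSpace n → ℝ, Continuous f → IntegrableOn f (Metric.ball (0 : EucSpace n) 1) :=
    fun f hf => (hf.continuousOn.integrableOn_compact
      (isCompact_closedBall 0 1)).mono_set Metric.ball_subset_closedBall
  -- Under this reflection `⟪y, e⟫` is odd, so only the odd part of `g` contributes; `y - R y = 2
  -- ⟪y, e⟫ e` then brings in the Lipschitz constant.
  set R := (Submodule.span ℝ {e})ᗮ.reflection with hRdef
  have hR : ∀ y, R y = y - (2 * (inner ℝ y e : ℝ)) • e := fun y => by
    rw [hRdef, Submodule.reflection_orthogonal_apply, Submodule.reflection_singleton_apply]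
    simp [he, two_smul, two_mul, add_smul, real_inner_comm]
  have h := R.measurePreserving.setIntegral_preimage_emb R.toMeasurableEquiv.measurableEmbedding
      (fun y => (inner ℝ y e : ℝ) * g y) (Metric.ball 0 1)
  have hball : R ⁻¹' Metric.ball 0 1 = Metric.ball 0 1 := by ext; simp
  have hRe : ∀ y, (inner ℝ (R y) e : ℝ) = -inner ℝ y e := fun y => by
    rw [hR, inner_sub_left, inner_smul_left, real_inner_self_eq_norm_sq, he]
    simp; ring
  rw [hball] at h
  simp only [hRe] at h
  have h2 : 2 * ∫ y in Metric.ball (0 : EucSpace n) 1, (inner ℝ y e : ℝ) * g y =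
      ∫ y in Metric.ball (0 : EucSpace n) 1, (inner ℝ y e : ℝ) * (g y - g (R y)) := by
    rw [two_mul]
    nth_rewrite 2 [← h]
    rw [← integral_add (hint _ (by fun_prop)) (hint _ (by fun_prop))]
    congr 1; funext y; ring
  have h3 : ∫ y in Metric.ball (0 : EucSpace n) 1, (inner ℝ y e : ℝ) * (g y - g (R y)) ≤
      ∫ y in Metric.ball (0 : EucSpace n) 1, (2 * K) * (inner ℝ y e : ℝ) ^ 2 := by
    refine integral_mono (hint _ (by fun_prop)) (hint _ (by fun_prop)) fun y => ?_
    have hd : |g y - g (R y)| ≤ K * (2 * |(inner ℝ y e : ℝ)|) := by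
      have := hg.dist_le_mul y (R y)
      rwa [Real.dist_eq, dist_eq_norm, hR, sub_sub_cancel, norm_smul, he, mul_one, Real.norm_eq_abs,
        abs_mul, abs_two, ← hR] at this
    calc (inner ℝ y e : ℝ) * (g y - g (R y)) ≤ |(inner ℝ y e : ℝ)| * |g y - g (R y)| := by
          rw [← abs_mul]; exact le_abs_self _
      _ ≤ |(inner ℝ y e : ℝ)| * (K * (2 * |(inner ℝ y e : ℝ)|)) := by gcongr
      _ = (2 * K) * (inner ℝ y e : ℝ) ^ 2 := by rw [← sq_abs]; ring
  rw [integral_const_mul] at h3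
  linarith

/-- Integrate `⟪y, a_q (g_q y)⟫` over the unit ball and over `μ`. In one order the lift property
gives `∫ ‖y‖²`, in the other the moment bounds give at most `(∫ K dμ) (∫ ‖y‖²) / n`. -/
theorem le_integral_of_isLift_id {n : ℕ} (hn : 0 < n) {μ : Measure (AxialProjector (EucSpace n))}
    (hμ : IsAxialPartition μ) {g : AxialProjector (EucSpace n) → EucSpace n → ℝ}
    (hg : IsLift μ (id : EucSpace n → EucSpace n) g) {K : AxialProjector (EucSpace n) → ℝ≥0}
    (hKint : Integrable (fun q => (K q : ℝ)) μ)
    (hgK : ∀ q, LipschitzWith (K q) (g q)) : (n : ℝ) ≤ ∫ q, (K q : ℝ) ∂μ := by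
  have := (hμ.mass).1
  obtain ⟨g', hm, hL, hae⟩ := exists_measurable_uncurry_of_lipschitz hgK
    fun y => (hg y).1.aestronglyMeasurable
  set B : Set (EucSpace n) := Metric.ball 0 1
  set ν : Measure (EucSpace n) := volume.restrict B
  have : IsFiniteMeasure ν := ⟨by
    rw [Measure.restrict_apply_univ]; exact measure_ball_lt_top⟩
  let H : EucSpace n → AxialProjector (EucSpace n) → ℝ := fun y q =>
    (inner ℝ y (q.axis 1) : ℝ) * g' q y
  have hB : ∀ᵐ y ∂ν, ‖y‖ ≤ 1 := by
    filter_upwards [ae_restrict_mem measurableSet_ball] with y hy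
    simpa using (mem_ball_zero_iff.1 hy).le
  have hHm : Measurable (Function.uncurry H) := by
    refine Measurable.mul ?_ hm
    have h2 : Continuous fun p : EucSpace n × EucSpace n => (inner ℝ p.1 p.2 : ℝ) := by fun_prop
    exact h2.measurable.comp (measurable_fst.prodMk
      (AxialProjector.continuous_axis_one.measurable.comp measurable_snd))
  have hg0 : Integrable (fun q => g' q 0) μ :=
    ((hg 0).1.integrable (by norm_num)).congr (hae.mono fun q hq => by simp only [hq])
  have hHint : Integrable (Function.uncurry H) (ν.prod μ) := by
    refine ((hg0.norm.add hKint).comp_snd ν).mono' hHm.aestronglyMeasurable ?_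
    filter_upwards [Measure.quasiMeasurePreserving_fst.ae hB] with p hp
    obtain ⟨y, q⟩ := p
    have h1 : ‖g' q y - g' q 0‖ ≤ K q * ‖y‖ := by
      simpa [dist_eq_norm] using (hL q).dist_le_mul y 0
    have h2 : ‖g' q y‖ ≤ ‖g' q 0‖ + K q := by
      have := norm_le_norm_add_norm_sub' (g' q y) (g' q 0)
      have : (K q : ℝ) * ‖y‖ ≤ K q := mul_le_of_le_one_right (K q).2 hp
      linarith
    have h3 : ‖(inner ℝ y (q.axis 1) : ℝ)‖ ≤ 1 := by
      refine (norm_inner_le_norm _ _).trans ?_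
      rw [q.norm_axis_one, mul_one]; exact hp
    change ‖_ * _‖ ≤ ‖g' q 0‖ + K q
    rw [norm_mul]
    exact (mul_le_of_le_one_left (norm_nonneg _) h3).trans h2
  have hswap := integral_integral_swap hHint
  have hleft : ∀ y, ∫ q, H y q ∂μ = ‖y‖ ^ 2 := fun y => by
    obtain ⟨-, h1, h2⟩ := hg y
    have h3 := integral_inner (𝕜 := ℝ) h1 y
    rw [h2, id, real_inner_self_eq_norm_sq] at h3
    rw [← h3]
    refine integral_congr_ae (hae.mono fun q hq => ?_)
    simp only [H, hq]
    rw [q.axis_eq_smul (g q y), inner_smul_right, mul_comm]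
  have hnc : ∀ q : AxialProjector (EucSpace n), (n : ℝ) * ∫ y, (inner ℝ y (q.axis 1) : ℝ) ^ 2 ∂ν =
      ∫ y, ‖y‖ ^ 2 ∂ν := fun q => setIntegral_ball_inner_sq q.norm_axis_one
  have hpos : 0 < ∫ y, ‖y‖ ^ 2 ∂ν := setIntegral_ball_norm_sq_pos hn
  have hn' : (0 : ℝ) < n := by exact_mod_cast hn
  have hright : ∀ q, ∫ y, H y q ∂ν ≤ K q * ((∫ y, ‖y‖ ^ 2 ∂ν) / n) := fun q => by
    rw [← hnc q, mul_div_cancel_left₀ _ hn'.ne']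
    exact setIntegral_ball_inner_mul_le q.norm_axis_one (hL q)
  have hle := integral_mono hHint.integral_prod_right (hKint.mul_const _) hright
  simp only [hleft] at hswap
  change ∫ q, ∫ y, H y q ∂ν ∂μ ≤ _ at hle
  rw [← hswap, integral_mul_const, mul_div_assoc', le_div_iff₀ hn', mul_comm] at hle
  exact le_of_mul_le_mul_right hle hpos

theorem sqrt_le_minTildeDil_id (n : ℕ) :
    (n : ℝ≥0∞) ^ (1 / 2 : ℝ) ≤ minTildeDil (id : EucSpace n → EucSpace n) := by
  rcases Nat.eq_zero_or_pos n with rfl | hn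
  · simp
  refine le_iInf₂ fun μ hμ => le_iInf₂ fun g hg => le_iInf₂ fun K hK => le_iInf fun hgK => ?_
  refine ENNReal.rpow_le_rpow ?_ (by norm_num)
  obtain ⟨hfin, hmass⟩ := hμ.mass
  by_cases htop : ∫⁻ q, (K q : ℝ≥0∞) ^ 2 ∂μ = ⊤
  · rw [htop]; exact le_top
  have hmeas : Measurable fun q => (K q : ℝ) := hK.coe_nnreal_real
  have e : ∀ q, ENNReal.ofReal ((K q : ℝ) ^ 2) = (K q : ℝ≥0∞) ^ 2 := fun q => by
    rw [ENNReal.ofReal_pow (K q).coe_nonneg, ENNReal.ofReal_coe_nnreal]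
  have hK2 : Integrable (fun q => (K q : ℝ) ^ 2) μ := by
    refine ⟨(hmeas.pow_const 2).aestronglyMeasurable, ?_⟩
    rw [hasFiniteIntegral_iff_ofReal (ae_of_all _ fun q => by positivity)]
    simp only [e]
    exact lt_top_iff_ne_top.2 htop
  have hKint : Integrable (fun q => (K q : ℝ)) μ := by
    refine (hK2.add (integrable_const 1)).mono' hmeas.aestronglyMeasurable (ae_of_all _ fun q => ?_)
    simp only [Pi.add_apply, Real.norm_eq_abs, NNReal.abs_eq]
    nlinarith [sq_nonneg ((K q : ℝ) - 1), (K q).2]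
  have h1 := le_integral_of_isLift_id hn hμ hg hKint hgK
  have h2 : 2 * ∫ q, (K q : ℝ) ∂μ ≤ ∫ q, (K q : ℝ) ^ 2 ∂μ + n := by
    have : ∫ q, (2 * K q : ℝ) ∂μ ≤ ∫ q, ((K q : ℝ) ^ 2 + 1) ∂μ :=
      integral_mono (hKint.const_mul 2) (hK2.add (integrable_const 1))
        fun q => by nlinarith [sq_nonneg ((K q : ℝ) - 1)]
    rw [integral_const_mul, integral_add hK2 (integrable_const 1)] at this
    simpa [hmass] using this
  have h3 : (n : ℝ) ≤ ∫ q, (K q : ℝ) ^ 2 ∂μ := by linarith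
  have h4 := ofReal_integral_eq_lintegral_ofReal hK2 (ae_of_all _ fun q => by positivity)
  simp only [e] at h4
  rw [← h4, ← ENNReal.ofReal_natCast]
  exact ENNReal.ofReal_le_ofReal h3

/-! ### The coordinate partition and the bound on the Hilbert Jacobian -/

instance (Y : Type*) [NormedAddCommGroup Y] [NormedSpace ℝ Y] : T2Space (AxialProjector Y) :=
  T2Space.of_injective_continuous (f := fun q : AxialProjector Y => (q.axis 1, q.proj))
    (fun q q' h => by
      obtain ⟨a, p, _, _⟩ := q
      obtain ⟨a', p', _, _⟩ := q'
      obtain ⟨h1, h2⟩ := Prod.mk.inj h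
      have : a = a' := LinearIsometry.toLinearMap_injective (LinearMap.ext_ring h1)
      subst this
      subst h2
      rfl) continuous_induced_dom

/-- The projector to the `i`-th coordinate axis. -/
noncomputable def coordProjector {n : ℕ} (i : Fin n) : AxialProjector (EucSpace n) where
  axis := LinearIsometry.toSpanSingleton ℝ (EucSpace n) (v := EuclideanSpace.single i (1 : ℝ))
    (by simp)
  proj := innerSL ℝ (EuclideanSpace.single i (1 : ℝ))
  proj_axis t := by simp
  norm_proj := by simp

theorem coordProjector_axis {n : ℕ} (i : Fin n) (t : ℝ) :
    (coordProjector i).axis t = t • EuclideanSpace.single i (1 : ℝ) := rfl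

theorem coordProjector_proj {n : ℕ} (i : Fin n) (y : EucSpace n) :
    (coordProjector i).proj y = y i := by
  simp [coordProjector, EuclideanSpace.inner_single_left]

theorem coordProjector_injective {n : ℕ} :
    Function.Injective (coordProjector : Fin n → AxialProjector (EucSpace n)) := by
  intro i j h
  have h1 : (coordProjector i).proj ((coordProjector j).axis 1) = 1 := by
    rw [h, (coordProjector j).proj_axis]
  rw [coordProjector_proj, coordProjector_axis] at h1
  by_contra hij
  simp [hij] at h1

/-- The coordinate axial partition of unity. -/
noncomputable def coordMeasure (n : ℕ) : Measure (AxialProjector (EucSpace n)) :=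
  ∑ i : Fin n, Measure.dirac (coordProjector i)

instance (n : ℕ) : IsFiniteMeasure (coordMeasure n) := by
  unfold coordMeasure; infer_instance

theorem integral_coordMeasure {n : ℕ} {E : Type*} [NormedAddCommGroup E] [NormedSpace ℝ E]
    [CompleteSpace E] (h : AxialProjector (EucSpace n) → E) :
    Integrable h (coordMeasure n) ∧ ∫ q, h q ∂(coordMeasure n) = ∑ i, h (coordProjector i) := by
  -- Points are Borel because the space of projectors is Hausdorff, so `h` needs no measurability.
  have hi : ∀ i ∈ Finset.univ, Integrable h (Measure.dirac (coordProjector (n := n) i)) :=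
    fun i _ => integrable_dirac (by simp)
  refine ⟨integrable_finsetSum_measure.2 hi, ?_⟩
  rw [coordMeasure, integral_finsetSum_measure hi]
  simp

theorem sum_smul_single {n : ℕ} (y : EucSpace n) :
    ∑ i, y i • EuclideanSpace.single i (1 : ℝ) = y := by
  simpa using (EuclideanSpace.basisFun (Fin n) ℝ).sum_repr y

theorem isAxialPartition_coordMeasure (n : ℕ) : IsAxialPartition (coordMeasure n) := fun y => by
  obtain ⟨h1, h2⟩ := integral_coordMeasure fun q : AxialProjector (EucSpace n) => q.axis (q.proj y)
  refine ⟨h1, h2.trans ?_⟩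
  simp only [coordProjector_proj, coordProjector_axis]
  exact sum_smul_single y

theorem minTildeDil_le_of_coord {n : ℕ} {X : Type*} [PseudoEMetricSpace X] {f : X → EucSpace n}
    (hf : ∀ i, LipschitzWith 1 fun x => f x i) : minTildeDil f ≤ (n : ℝ≥0∞) ^ (1 / 2 : ℝ) := by
  classical
  let g : AxialProjector (EucSpace n) → X → ℝ := fun q x =>
    ∑ i, if q = coordProjector i then f x i else 0
  have hgi : ∀ i x, g (coordProjector i) x = f x i := fun i x => by
    simp only [g, coordProjector_injective.eq_iff]
    simp
  have hg0 : ∀ q, (∀ i, q ≠ coordProjector i) → g q = 0 := fun q hq => by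
    funext x
    simp [g, hq]
  have hlift : IsLift (coordMeasure n) f g := fun x => by
    have h1 := integral_coordMeasure fun q : AxialProjector (EucSpace n) => g q x ^ 2
    have h2 := integral_coordMeasure fun q : AxialProjector (EucSpace n) => q.axis (g q x)
    have h3 := integral_coordMeasure fun q : AxialProjector (EucSpace n) => g q x
    refine ⟨(memLp_two_iff_integrable_sq h3.1.aestronglyMeasurable).2 h1.1, h2.1, h2.2.trans ?_⟩
    simp only [hgi, coordProjector_axis]
    exact sum_smul_single _
  have hL : ∀ q, LipschitzWith 1 (g q) := fun q => by
    by_cases hq : ∃ i, q = coordProjector i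
    · obtain ⟨i, rfl⟩ := hq
      rw [show g (coordProjector i) = fun x => f x i from funext (hgi i)]
      exact hf i
    · push Not at hq
      rw [hg0 q hq]
      exact LipschitzWith.const' (0 : ℝ)
  refine (iInf₂_le _ (isAxialPartition_coordMeasure n)).trans ((iInf₂_le g hlift).trans
    ((iInf₂_le (fun _ => 1) measurable_const).trans ((iInf_le _ hL).trans (le_of_eq ?_))))
  simp [coordMeasure]

/-- The whole space and the identity diffeomorphism suffice: numerator and denominator of the
Hilbert constant are bounded by the same `√n`, from above and below. -/
theorem hilJac_le_one {n : ℕ} {X : Type*} [PseudoEMetricSpace X] {f : X → EucSpace n}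
    (hf : ∀ i, LipschitzWith 1 fun x => f x i) (x : X) : hilJac f x ≤ 1 := by
  refine (iInf₂_le univ Filter.univ_mem).trans ((iInf₂_le (Diffeomorph.refl _ _ _) ?_).trans ?_)
  · intro v
    have : fderiv ℝ (Diffeomorph.refl 𝓘(ℝ, EucSpace n) (EucSpace n) ∞) v =
        ContinuousLinearMap.id ℝ _ := fderiv_id
    rw [this, ContinuousLinearMap.det, ContinuousLinearMap.coe_id, LinearMap.det_id, abs_one]
  · refine pow_le_one₀ zero_le (ENNReal.div_le_of_le_mul ?_)
    rw [one_mul]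
    refine le_trans (minTildeDil_le_of_coord fun i => ?_) (sqrt_le_minTildeDil_id n)
    simpa [Function.comp_def] using (hf i).comp (LipschitzWith.subtype_val (univ : Set X))

/-! ### The inequality -/

theorem volume_euclideanBox {n : ℕ} (d : Fin n → ℝ) :
    volume {y : EucSpace n | ∀ i, y i ∈ Ioo 0 (d i)} = ∏ i, ENNReal.ofReal (d i) := by
  have h : {y : EucSpace n | ∀ i, y i ∈ Ioo 0 (d i)} =
      WithLp.ofLp ⁻¹' (univ.pi fun i => Ioo 0 (d i)) := by
    ext y; simp
  rw [h, (PiLp.volume_preserving_ofLp (Fin n)).measure_preimage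
    (MeasurableSet.univ_pi fun _ => measurableSet_Ioo).nullMeasurableSet, Real.volume_pi_Ioo]
  simp

/-- The map to the cube that blows up the cube with centre `y` and edge `2 s`. -/
noncomputable def blowUp {n : ℕ} (y : EucSpace n) (s : ℝ) : C(EucSpace n, Fin n → unitInterval) where
  toFun z i := projIcc 0 1 zero_le_one (1 / 2 + (z i - y i) / (2 * s))
  continuous_toFun := by
    refine continuous_pi fun i => continuous_projIcc.comp ?_
    fun_prop

theorem blowUp_eq_zero {n : ℕ} {y z : EucSpace n} {s : ℝ} (hs : 0 < s) {i : Fin n}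
    (h : z i ≤ y i - s) : blowUp y s z i = 0 := by
  refine projIcc_of_le_left zero_le_one ?_
  have : (z i - y i) / (2 * s) ≤ -(1 / 2) := by
    rw [div_le_iff₀ (by positivity)]; linarith
  linarith

theorem blowUp_eq_one {n : ℕ} {y z : EucSpace n} {s : ℝ} (hs : 0 < s) {i : Fin n}
    (h : y i + s ≤ z i) : blowUp y s z i = 1 := by
  refine projIcc_of_right_le zero_le_one ?_
  have : 1 / 2 ≤ (z i - y i) / (2 * s) := by
    rw [le_div_iff₀ (by positivity)]; linarith
  linarith

theorem blowUp_mem_boundary {n : ℕ} {y z : EucSpace n} {s : ℝ} (hs : 0 < s)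
    (h : ¬ ∀ i, |z i - y i| < s) : blowUp y s z ∈ (standardCube n).boundary := by
  push Not at h
  obtain ⟨i, hi⟩ := h
  refine mem_iUnion.2 ⟨i, ?_⟩
  rcases le_abs.1 hi with hi | hi
  · exact Or.inl (blowUp_eq_one hs (by linarith))
  · exact Or.inr (blowUp_eq_zero hs (by linarith))

/-- The interior points of the box are stable for a map of cubes in the class of a non-trivial
face map. -/
theorem isStablePoint_of_faceMap {n : ℕ} {X : Type*} [PseudoMetricSpace X]
    (Q : CubicalStructure n X) (F : Type*) [AddCommGroup F] (π : FaceMap Q)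
    (hπ : cechMap F n π.toContinuousMap π.mapsTo_boundary ≠ 0) (f : C(X, EucSpace n))
    {d : Fin n → ℝ} (hpos : ∀ i, ∀ x ∈ Q.pos i, f x i = d i) (hneg : ∀ i, ∀ x ∈ Q.neg i, f x i = 0)
    {y : EucSpace n} (hy : ∀ i, y i ∈ Ioo 0 (d i)) : IsStablePoint F n f y := by
  have hSo : IsOpen {z : EucSpace n | ∀ i, z i ∈ Ioo 0 (d i)} := by
    simp only [ofPred_forall]
    exact isOpen_iInter_of_finite fun i => isOpen_Ioo.preimage (by fun_prop)
  -- A closed `W` keeps even the closure of `V` in the open box, so `f` takes the faces off it, as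
  -- excision requires.
  obtain ⟨W, hW, hWc, hWS⟩ := exists_mem_nhds_isClosed_subset (hSo.mem_nhds hy)
  refine ⟨W, hW, fun V hV hVW => ?_⟩
  have hVS : closure V ⊆ {z : EucSpace n | ∀ i, z i ∈ Ioo 0 (d i)} :=
    (closure_minimal hVW hWc).trans hWS
  obtain ⟨s, hs, hsV, hsy⟩ : ∃ s : ℝ, 0 < s ∧ (∀ z : EucSpace n, (∀ i, |z i - y i| < s) →
      z ∈ interior V) ∧ ∀ i, s < y i ∧ s < d i - y i := by
    have h1 : WithLp.toLp 2 ⁻¹' interior V ∈ 𝓝 (WithLp.ofLp y) :=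
      (PiLp.continuous_toLp 2 _).continuousAt.preimage_mem_nhds (interior_mem_nhds.2 hV)
    obtain ⟨s₀, hs₀, hball⟩ := Metric.mem_nhds_iff.1 h1
    have h2 : ∀ᶠ s in 𝓝[>] (0 : ℝ), s < s₀ ∧ ∀ i, s < y i ∧ s < d i - y i := by
      have hlt : ∀ c : ℝ, 0 < c → ∀ᶠ s in 𝓝[>] (0 : ℝ), s < c := fun c hc =>
        (eventually_lt_nhds hc).filter_mono nhdsWithin_le_nhds
      exact (hlt _ hs₀).and (Filter.eventually_all.2 fun i =>
        (hlt _ (hy i).1).and (hlt _ (sub_pos.2 (hy i).2)))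
    obtain ⟨s, ⟨hs1, hs2⟩, hs⟩ := (h2.and self_mem_nhdsWithin).exists
    refine ⟨s, hs, fun z hz => hball ?_, hs2⟩
    exact (dist_pi_lt_iff hs₀).2 fun i => (hz i).trans hs1
  obtain ⟨φ, hφ, hne⟩ := (cechMap_ne_zero_iff F n _ _).1 hπ
  have hout : ∀ z ∉ interior V, blowUp y s z ∈ (standardCube n).boundary := fun z hz =>
    blowUp_mem_boundary hs fun h => hz (hsV z h)
  let rV : C(closure V, Fin n → unitInterval) :=
    (blowUp y s).comp ⟨Subtype.val, continuous_subtype_val⟩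
  refine (cechMap_ne_zero_iff F n _ _).2 ⟨cechPull F n rV φ,
    cechPull_cocycles F n rV (fun z hz => hout z hz.2) hφ, fun hcob => hne ?_⟩
  have hface : ∀ x ∈ Q.boundary, ∃ i,
      (π.toContinuousMap x i = 1 ∧ (blowUp y s).comp f x i = 1) ∨
      (π.toContinuousMap x i = 0 ∧ (blowUp y s).comp f x i = 0) := fun x hx => by
    obtain ⟨i, hi⟩ := mem_iUnion.1 hx
    refine ⟨i, hi.imp (fun h => ⟨π.mapsTo_pos i h, blowUp_eq_one hs ?_⟩)
      (fun h => ⟨π.mapsTo_neg i h, blowUp_eq_zero hs ?_⟩)⟩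
    · rw [hpos i x h]; linarith [(hsy i).2]
    · rw [hneg i x h]; linarith [(hsy i).1]
  have hB := (standardCube n).isClosed_boundary
  have hdiff : closure V \ frontier V = interior V := by
    rw [frontier, sdiff_sdiff_cancel_left (interior_subset.trans subset_closure)]
  have hexc := cechPull_mem_cechCoboundaries_of_excision (T := Q.boundary) hB
    ((blowUp y s).comp f) (isClosed_closure.preimage f.continuous)
    (A := f ⁻¹' frontier V)
    (by rw [← preimage_sdiff, hdiff]; exact isOpen_interior.preimage f.continuous)
    (preimage_mono frontier_subset_closure)
    (disjoint_left.2 fun x hx hxV => by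
      obtain ⟨i, hi⟩ := mem_iUnion.1 hx
      have := hVS hxV i
      rcases hi with hi | hi
      · rw [hpos i x hi] at this; exact lt_irrefl _ this.2
      · rw [hneg i x hi] at this; exact lt_irrefl _ this.1)
    (fun x hx => hout _ fun h => hx (by rw [← preimage_sdiff, hdiff]; exact h)) hφ hcob
  simpa using add_mem (cechPull_sub_mem_of_commonFace _ _ hface hφ) hexc

/-- A face map is trivial if one of the faces is empty. -/
theorem cechMap_eq_zero_of_face_eq_empty {n : ℕ} {X : Type*} [TopologicalSpace X]
    (Q : CubicalStructure n X) (F : Type*) [AddCommGroup F] (π : FaceMap Q) (i : Fin n)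
    (h : Q.pos i = ∅ ∨ Q.neg i = ∅) :
    cechMap F n π.toContinuousMap π.mapsTo_boundary = 0 := by
  by_contra hπ
  obtain ⟨φ, hφ, hne⟩ := (cechMap_ne_zero_iff F n _ _).1 hπ
  -- With one of the two faces empty, coordinate `i` can be pushed to the opposite end of the
  -- interval. The resulting map shares faces with `π` and lies in `∂□`.
  obtain ⟨c, hc01, hc⟩ : ∃ c : unitInterval, (c = 1 ∨ c = 0) ∧ ∀ x,
      (x ∈ Q.pos i → c = 1) ∧ (x ∈ Q.neg i → c = 0) := by
    rcases h with h | h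
    · exact ⟨0, Or.inr rfl, fun x => ⟨fun hx => by simp [h] at hx, fun _ => rfl⟩⟩
    · exact ⟨1, Or.inl rfl, fun x => ⟨fun _ => rfl, fun hx => by simp [h] at hx⟩⟩
  let g : C(X, Fin n → unitInterval) :=
    ⟨fun x => Function.update (π.toContinuousMap x) i c, by fun_prop⟩
  have hg : ∀ x j, g x j = if j = i then c else π.toContinuousMap x j := fun x j => by
    simp [g, Function.update_apply]
  refine hne ?_
  have h1 := cechPull_sub_mem_of_commonFace (A := Q.boundary) π.toContinuousMap g (fun x hx => by
    obtain ⟨j, hj⟩ := mem_iUnion.1 hx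
    refine ⟨j, hj.imp (fun hx => ?_) (fun hx => ?_)⟩
    · have hπj : π.toContinuousMap x j = 1 := π.mapsTo_pos j hx
      refine ⟨hπj, ?_⟩
      rw [hg]
      split_ifs with hji
      · subst hji; exact (hc x).1 hx
      · exact hπj
    · have hπj : π.toContinuousMap x j = 0 := π.mapsTo_neg j hx
      refine ⟨hπj, ?_⟩
      rw [hg]
      split_ifs with hji
      · subst hji; exact (hc x).2 hx
      · exact hπj) hφ
  have h2 := cechPull_mem_cechCoboundaries_of_range_subset (A := Q.boundary) hφ g fun x =>
    mem_iUnion.2 ⟨i, hc01.imp (fun h => show g x i = 1 by simp [hg, h])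
      (fun h => show g x i = 0 by simp [hg, h])⟩
  simpa using add_mem h1 h2

/-- Nontriviality of the face map excludes empty faces, so all the distances are finite and the
truncated distance functions define a map onto whose box stability applies. -/
theorem prod_setDist_le_glbVol {n : ℕ} {X : Type*} [MetricSpace X] (Q : CubicalStructure n X)
    (F : Type*) [AddCommGroup F] (π : FaceMap Q)
    (hπ : cechMap F n π.toContinuousMap π.mapsTo_boundary ≠ 0) :
    ∏ i : Fin n, setDist (Q.pos i) (Q.neg i) ≤ glbVol F n X := by
  have hne : ∀ i, (Q.pos i).Nonempty ∧ (Q.neg i).Nonempty := fun i => by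
    by_contra h
    rw [not_and_or, not_nonempty_iff_eq_empty, not_nonempty_iff_eq_empty] at h
    exact hπ (cechMap_eq_zero_of_face_eq_empty Q F π i h)
  have htop : ∀ i, setDist (Q.pos i) (Q.neg i) ≠ ⊤ := fun i => by
    obtain ⟨⟨p, hp⟩, q, hq⟩ := hne i
    exact ne_top_of_le_ne_top (edist_ne_top p q) ((iInf₂_le p hp).trans (iInf₂_le q hq))
  let d : Fin n → ℝ := fun i => (setDist (Q.pos i) (Q.neg i)).toReal
  -- Truncating at `d i` puts the positive face exactly on the hyperplane `y i = d i`.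
  let f₀ : X → Fin n → ℝ := fun x i => min (Metric.infDist x (Q.neg i)) (d i)
  have hf₀ : ∀ i, LipschitzWith 1 fun x => f₀ x i := fun i =>
    (Metric.lipschitz_infDist_pt _).min_const _
  have hL : LipschitzWith _ fun x => (WithLp.toLp 2 (f₀ x) : EucSpace n) :=
    (PiLp.lipschitzWith_toLp 2 fun _ : Fin n => ℝ).comp 
      (LipschitzWith.of_edist_le fun x y => edist_pi_le_iff.2 fun i => by
        simpa using hf₀ i x y : LipschitzWith 1 f₀)
  let f : C(X, EucSpace n) := ⟨fun x => WithLp.toLp 2 (f₀ x), hL.continuous⟩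
  have hpos : ∀ i, ∀ x ∈ Q.pos i, f x i = d i := fun i x hx => by
    refine min_eq_right ((Metric.le_infDist (hne i).2).2 fun z hz => ?_)
    rw [dist_edist]
    exact ENNReal.toReal_mono (edist_ne_top _ _) ((iInf₂_le x hx).trans (iInf₂_le z hz))
  have hneg : ∀ i, ∀ x ∈ Q.neg i, f x i = 0 := fun i x hx => by
    change min (Metric.infDist x (Q.neg i)) (d i) = 0
    rw [Metric.infDist_zero_of_mem hx, min_eq_left ENNReal.toReal_nonneg]
  calc ∏ i : Fin n, setDist (Q.pos i) (Q.neg i) = ∏ i, ENNReal.ofReal (d i) :=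
        Finset.prod_congr rfl fun i _ => (ENNReal.ofReal_toReal (htop i)).symm
    _ = volume {y : EucSpace n | ∀ i, y i ∈ Ioo 0 (d i)} := (volume_euclideanBox d).symm
    _ ≤ volume (stableImage F n f) := measure_mono fun y hy =>
        isStablePoint_of_faceMap Q F π hπ f hpos hneg hy
    _ ≤ glbVol F n X := le_iSup_of_le f (le_iSup_of_le ⟨_, hL⟩
        (le_iSup_of_le (fun x => hilJac_le_one hf₀ x) le_rfl))

theorem glbVol_univ_le_hilVol (F : Type*) [AddCommGroup F] (n : ℕ) (X : Type*)
    [PseudoEMetricSpace X] : glbVol F n (univ : Set X) ≤ hilVol F n X := by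
  -- The single set `univ`, padded by empty sets, has multiplicity `1`.
  let U : ℕ → Set X := fun k => Nat.casesOn k univ fun _ => ∅
  have hU : ∀ k, IsOpen (U k) := fun k => by
    cases k
    exacts [isOpen_univ, isOpen_empty]
  refine le_iSup₂_of_le U hU (le_iSup₂_of_le 1 one_pos (le_iSup_of_le (fun x => ?_) ?_))
  · refine (encard_le_encard (t := {0}) fun k hk => ?_).trans (by simp)
    cases k with
    | zero => rfl
    | succ k => exact hk.elim
  · rw [Nat.cast_one, inv_one, one_mul]
    exact ENNReal.le_tsum (f := fun i => glbVol F n ↥(U i)) 0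

theorem mainTheorem9 {n : ℕ} {P : Type*} [MetricSpace P] (Q : CubicalStructure n P)
    (F : Type*) [AddCommGroup F] (π : FaceMap Q)
    (hπ : cechMap F n π.toContinuousMap π.mapsTo_boundary ≠ 0) :
    ∏ i : Fin n, setDist (Q.pos i) (Q.neg i) ≤ hilVol F n P := by
  -- `hilVol` sees `P` only through its open subsets as subtypes, so the cubical structure and the
  -- face map are carried to the subtype `univ`; `mk` carries a coboundary back.
  let val : C((univ : Set P), P) := ⟨Subtype.val, continuous_subtype_val⟩
  let mk : C(P, (univ : Set P)) := ⟨fun x => ⟨x, mem_univ x⟩, by fun_prop⟩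
  let Q' : CubicalStructure n (univ : Set P) :=
    { pos := fun i => val ⁻¹' Q.pos i
      neg := fun i => val ⁻¹' Q.neg i
      isClosed_pos := fun i => (Q.isClosed_pos i).preimage val.continuous
      isClosed_neg := fun i => (Q.isClosed_neg i).preimage val.continuous
      disjoint := fun i => (Q.disjoint i).preimage val }
  let π' : FaceMap Q' :=
    { toContinuousMap := π.toContinuousMap.comp val
      mapsTo_pos := fun i _ hx => π.mapsTo_pos i hx
      mapsTo_neg := fun i _ hx => π.mapsTo_neg i hx }
  have hπ' : cechMap F n π'.toContinuousMap π'.mapsTo_boundary ≠ 0 := by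
    obtain ⟨φ, hφ, hne⟩ := (cechMap_ne_zero_iff F n _ _).1 hπ
    refine (cechMap_ne_zero_iff F n _ _).2 ⟨φ, hφ, fun h => hne ?_⟩
    refine cechPull_coboundaries F n mk (A := Q.boundary) (B := Q'.boundary) (fun x hx => ?_) h
    obtain ⟨i, hi⟩ := mem_iUnion.1 hx
    exact mem_iUnion.2 ⟨i, hi⟩
  refine le_trans ?_ ((prod_setDist_le_glbVol Q' F π' hπ').trans (glbVol_univ_le_hilVol F n P))
  exact Finset.prod_le_prod' fun i _ => le_iInf₂ fun x hx => le_iInf₂ fun z hz =>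
    (iInf₂_le (x : P) hx).trans (iInf₂_le (z : P) hz)
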